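/- Let $n\ge 1$, let $s\in(1,\infty)\setminus\mathbb N$ with integer part $[s]$ and fractional part $\{s\}$, and let $A:[0,\infty)\to[0,\infty]$ be a Young function (convex, left-continuous, non-constant in $(0,\infty)$, $A(0)=0$). Let $V^{s,A}(\mathbb R^n)$ be the space of $[s]$-times weakly differentiable functions $u$ on $\mathbb R^n$ such that $$|\nabla^{[s]}u|_{\{s\},A,\mathbb R^n}=\inf\Big\{\lambda>0:\int_{\mathbb R^n}\int_{\mathbb R^n}A\Big(\frac{|\nabla^{[s]}u(x)-\nabla^{[s]}u(y)|}{\lambda|x-y|^{\{s\}}}\Big)\frac{dx\,dy}{|x-y|^n}\le 1\Big\}<\infty ,$$ and, for an integer $0\le m\le[s]$, let $V^{s,A}_{d,m}(\mathbb R^n)$ be the subspace of those $u\in V^{s,A}(\mathbb R^n)$ with $|\{|\nabla^h u|>t\}|<\infty$ for all $t>0$ and all $h=m,\dots,[s]$. Call $\varphi:(0,\infty)\to(0,\infty)$ admissible if $\inf_{[a,\infty)}\varphi>0$ for every $a>0$. For an integer $k\ge0$, let $\mathcal L^{k,\varphi}(\mathbb R^n)$ be the space of $u\in W^{k,1}_{\rm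 loc}(\mathbb R^n)$ (with $W^{0,1}_{\rm loc}=L^1_{\rm loc}$) such that $$|u|_{\mathcal L^{k,\varphi}(\mathbb R^n)}=\sup_{B}\frac1{\varphi(|B|^{1/n})\,|B|^{k/n}}\,\frac1{|B|}\int_B|u-P^k_B[u]|\,dx<\infty ,$$ where the supremum is over all balls $B\subset\mathbb R^n$ and $P^k_B[u]$ is the unique polynomial of degree at most $k$ with $\int_B(\nabla^hu-\nabla^hP^k_B[u])\,dx=0$ for $h=0,\dots,k$. Theorem. Assume that for some admissible function $\varphi$ and some $k\in\{0,\dots,[s]-1\}$ the continuous embedding $$V^{s,A}_{d,k+1}(\mathbb R^n)\to\mathcal L^{k,\varphi}(\mathbb R^n)$$ holds, that is, $V^{s,A}_{d,k+1}(\mathbb R^n)\subset\mathcal L^{k,\varphi}(\mathbb R^n)$ and there is a constant $c$ with $|u|_{\mathcal L^{k,\varphi}(\mathbb R^n)}\le c\,|\nabla^{[s]}u|_{\{s\},A,\mathbb R^n}$ for all $u\in V^{s,A}_{d,k+1}(\mathbb R^n)$. Then $s<n+k+1$, and there is $\delta>0$ such that $$\int_0^\delta\Big(\frac t{A(t)}\Big)^{\frac{s-(k+1)}{n-(s-(k+1))}}\,dt<\infty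 ,$$ where $t/0=\infty$ and $t/\infty=0$ for $t>0$. -/

import Mathlib

open MeasureTheory Set
open scoped NNReal ENNReal

noncomputable section

/-- A function `φ : (0,∞) → (0,∞)` (only its values on `(0,∞)` matter) is admissible if its
infimum over `[a,∞)` is positive for every `a > 0`. -/
structure IsAdmissible (φ : ℝ → ℝ) : Prop where
  pos : ∀ r : ℝ, 0 < r → 0 < φ r
  inf_pos : ∀ a : ℝ, 0 < a → ∃ m : ℝ, 0 < m ∧ ∀ r : ℝ, a ≤ r → m ≤ φ r

/-- Young functions `A : [0,∞) → [0,∞]`: convex, left-continuous, non-constant in `(0,∞)`,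
and vanishing at `0`. -/
structure IsYoungFunction (A : ℝ≥0 → ℝ≥0∞) : Prop where
  convex : ConvexOn ℝ≥0 univ A
  leftCont : ∀ t : ℝ≥0, ContinuousWithinAt A (Iic t) t
  nonconst : ∃ a b : ℝ≥0, 0 < a ∧ 0 < b ∧ A a ≠ A b
  map_zero : A 0 = 0

/-- The classical gradient of order `h`: the vector of all partial derivatives
`∂_{i₁} ⋯ ∂_{i_h} f (x)`, indexed by the `h`-tuples `(i₁, …, i_h)`, with its Euclidean norm. -/
def classicalGrad {n : ℕ} (h : ℕ) (f : EuclideanSpace ℝ (Fin n) → ℝ)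
    (x : EuclideanSpace ℝ (Fin n)) : EuclideanSpace ℝ (Fin h → Fin n) :=
  WithLp.toLp 2 fun i : Fin h → Fin n =>
    iteratedFDeriv ℝ h f x fun j : Fin h => EuclideanSpace.single (i j) (1 : ℝ)

/-- `g` is a weak gradient of order `h` of `u` on `ℝⁿ`: both are locally integrable, and each
component of `g` is the corresponding distributional derivative of `u`. -/
structure IsWeakGrad {n : ℕ} (h : ℕ) (u : EuclideanSpace ℝ (Fin n) → ℝ)
    (g : EuclideanSpace ℝ (Fin n) → EuclideanSpace ℝ (Fin h → Fin n)) : Prop where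
  locallyIntegrable : LocallyIntegrable u volume
  locallyIntegrable_grad : LocallyIntegrable g volume
  integral_eq : ∀ η : EuclideanSpace ℝ (Fin n) → ℝ, ContDiff ℝ (⊤ : ℕ∞) η → HasCompactSupport η →
    ∀ i : Fin h → Fin n,
      ∫ x, u x * classicalGrad h η x i = (-1 : ℝ) ^ h * ∫ x, g x i * η x

/-- `u` is `m`-times weakly differentiable: `u` and its weak derivatives of orders up to `m`
exist as locally integrable functions. This is also `u ∈ W^{m,1}_loc(ℝⁿ)`. -/
def IsWeaklyDiff {n : ℕ} (m : ℕ) (u : EuclideanSpace ℝ (Fin n) → ℝ) : Prop :=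
  ∀ h : ℕ, h ≤ m → ∃ g, IsWeakGrad h u g

open Classical in
/-- The weak gradient `∇^h u` (unique up to null sets where it exists; `0` otherwise). -/
def weakGrad {n : ℕ} (h : ℕ) (u : EuclideanSpace ℝ (Fin n) → ℝ) :
    EuclideanSpace ℝ (Fin n) → EuclideanSpace ℝ (Fin h → Fin n) :=
  if H : ∃ g, IsWeakGrad h u g then H.choose else 0

/-- The functional `J_{σ,A}(v / l)`, that is
`∬ A (|v x - v y| / (l |x - y|^σ)) |x - y|^{-n} dx dy`. -/
def fracModular {n : ℕ} {F : Type*} [NormedAddCommGroup F] (σ : ℝ) (A : ℝ≥0 → ℝ≥0∞)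
    (v : EuclideanSpace ℝ (Fin n) → F) (l : ℝ≥0) : ℝ≥0∞ :=
  ∫⁻ x, ∫⁻ y, A (‖v x - v y‖₊ / (l * ‖x - y‖₊ ^ σ)) / ‖x - y‖ₑ ^ n

/-- The seminorm `|v|_{σ,A,ℝⁿ}`, the infimum of all `l > 0` such that `J_{σ,A}(v / l) ≤ 1`
(it is `∞` if there are none). -/
def fracSeminorm {n : ℕ} {F : Type*} [NormedAddCommGroup F] (σ : ℝ) (A : ℝ≥0 → ℝ≥0∞)
    (v : EuclideanSpace ℝ (Fin n) → F) : ℝ≥0∞ :=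
  ⨅ (l : ℝ≥0) (_ : 0 < l) (_ : fracModular σ A v l ≤ 1), (l : ℝ≥0∞)

/-- The fractional Orlicz-Sobolev seminorm `|∇^{[s]} u|_{{s},A,ℝⁿ}`. -/
def orliczSobolevSeminorm {n : ℕ} (s : ℝ) (A : ℝ≥0 → ℝ≥0∞)
    (u : EuclideanSpace ℝ (Fin n) → ℝ) : ℝ≥0∞ :=
  fracSeminorm (Int.fract s) A (weakGrad ⌊s⌋₊ u)

/-- The homogeneous fractional Orlicz-Sobolev space `V^{s,A}(ℝⁿ)`, `s ∈ (0,∞) \ ℕ`. -/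
def orliczSobolevSpace (n : ℕ) (s : ℝ) (A : ℝ≥0 → ℝ≥0∞) :
    Set (EuclideanSpace ℝ (Fin n) → ℝ) :=
  {u | IsWeaklyDiff ⌊s⌋₊ u ∧ orliczSobolevSeminorm s A u < ∞}

/-- The subspace `V^{s,A}_{d,k}(ℝⁿ)` of the functions in `V^{s,A}(ℝⁿ)` whose derivatives of
orders `k, …, [s]` decay near infinity in the weak sense. -/
def orliczSobolevDecaySpace (n : ℕ) (s : ℝ) (A : ℝ≥0 → ℝ≥0∞) (k : ℕ) :
    Set (EuclideanSpace ℝ (Fin n) → ℝ) :=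
  {u | u ∈ orliczSobolevSpace n s A ∧
    ∀ h : ℕ, k ≤ h → h ≤ ⌊s⌋₊ → ∀ t : ℝ, 0 < t → volume {x | t < ‖weakGrad h u x‖} < ∞}

/-- `P` has degree at most `k`, and `∫_B (∇^h u - ∇^h P) = 0` for `h = 0, …, k`. -/
def IsAveragingPolynomial {n : ℕ} (k : ℕ) (B : Set (EuclideanSpace ℝ (Fin n)))
    (u : EuclideanSpace ℝ (Fin n) → ℝ) (P : MvPolynomial (Fin n) ℝ) : Prop :=
  P.totalDegree ≤ k ∧ ∀ h : ℕ, h ≤ k →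
    ∫ x in B, (weakGrad h u x -
      classicalGrad h (fun y : EuclideanSpace ℝ (Fin n) => MvPolynomial.eval (fun i => y i) P) x)
        = 0

open Classical in
/-- The polynomial `P^k_B[u]` (it exists and is unique for `u ∈ W^{k,1}_loc` and `B` a ball). -/
def averagingPolynomial {n : ℕ} (k : ℕ) (B : Set (EuclideanSpace ℝ (Fin n)))
    (u : EuclideanSpace ℝ (Fin n) → ℝ) : MvPolynomial (Fin n) ℝ :=
  if H : ∃ P, IsAveragingPolynomial k B u P then H.choose else 0

/-- The Campanato seminorm of order `k`: the supremum over all balls `B` of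
`φ(|B|^{1/n})⁻¹ |B|^{-k/n} ⨍_B |u - P^k_B[u]|`. -/
def campanatoSeminorm {n : ℕ} (k : ℕ) (φ : ℝ → ℝ) (u : EuclideanSpace ℝ (Fin n) → ℝ) : ℝ≥0∞ :=
  ⨆ (z : EuclideanSpace ℝ (Fin n)) (r : ℝ) (_ : 0 < r),
    ((∫⁻ x in Metric.ball z r,
        ‖u x - MvPolynomial.eval (fun i => x i) (averagingPolynomial k (Metric.ball z r) u)‖ₑ) /
      volume (Metric.ball z r)) /
      ENNReal.ofReal
        (φ (volume.real (Metric.ball z r) ^ (1 / (n : ℝ))) *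
          volume.real (Metric.ball z r) ^ ((k : ℝ) / (n : ℝ)))

/-- The Campanato space `𝓛^{k,φ}(ℝⁿ)` (for `k = 0` this is `𝓛^φ(ℝⁿ)`). -/
def campanatoSpace (n : ℕ) (k : ℕ) (φ : ℝ → ℝ) : Set (EuclideanSpace ℝ (Fin n) → ℝ) :=
  {u | IsWeaklyDiff k u ∧ campanatoSeminorm k φ u < ∞}

/-- The continuous embedding `V^{s,A}_{d,m}(ℝⁿ) → 𝓛^{k,φ}(ℝⁿ)` of seminormed spaces: inclusion,
with a bound of the target seminorm by a constant times the seminorm of the domain. -/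
def CampanatoEmbedding (n : ℕ) (s : ℝ) (A : ℝ≥0 → ℝ≥0∞) (m k : ℕ) (φ : ℝ → ℝ) : Prop :=
  orliczSobolevDecaySpace n s A m ⊆ campanatoSpace n k φ ∧
    ∃ c : ℝ≥0, ∀ u ∈ orliczSobolevDecaySpace n s A m,
      campanatoSeminorm k φ u ≤ c * orliczSobolevSeminorm s A u

end

/-!
Put `γ = s - (k + 1) > 0`, `σ = {s}` and `m = [s]`. If the embedding holds, then the mean distance
on the unit ball to the polynomials of degree at most `k` is bounded over all
`u ∈ C_c^∞` whose seminorm is at most `1` (`CampanatoEmbedding.exists_lintegral_le`). If the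
conclusion fails, functions for which it is arbitrarily large are built as superpositions
`u = ∑_j c a_j R_j ^ s Ψ (x / R_j)`, `R_j = 2 ^ j`, of dilates of one cut-off monomial `Ψ`, equal to
`x₁ ^ (k + 1)` on the unit ball.

* On the unit ball, `u` is `c ∑_j R_j ^ γ a_j` times `x₁ ^ (k + 1)`, and this monomial has positive
  distance to the polynomials of degree at most `k`, since a finite difference of order `k + 1`
  annihilates these but not the monomial (`exists_mul_le_lintegral_monomial_sub`).
* The gradient of order `m` of `u` is `∑_j c a_j R_j ^ σ Γ (x / R_j)` with `Γ = ∇^m Ψ`. At a pair of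
  points at distance `r`, the scale `j` contributes to the difference quotient at most a constant
  times `a_j min ((R_j / r) ^ σ, (r / R_j) ^ (1 - σ))`. These weights have a bounded sum over `j`,
  so Jensen's inequality separates the scales. As the integral of each weight against
  `|z| ^ (-n) dz` is scale invariant, the modular of `∇^m u` is at most a constant times
  `∑_j R_j ^ n A (a_j)` (`exists_fracModular_dyadic_le`).

It remains to find finite sequences for which `∑_j R_j ^ n A (a_j)` is small and `∑_j R_j ^ γ a_j`
is large; note that `γ ≠ n`, as `s` is not an integer. If `γ > n`, one large scale is enough,
because `A` is at most linear near `0`. If `γ < n` and the integral of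
`(t / A t) ^ (γ / (n - γ))` diverges at `0`, let `D_j` be the initial interval of `(0, 1)`
on which `A t ≤ η R_j ^ (γ - n) t`. Then `R_j ^ n A (a_j) ≤ η R_j ^ γ a_j` for
`a_j = |D_j| / 2`, while the layers of the integrand show that `∑_j R_j ^ γ |D_j|` diverges. By convexity
of `A`, a partial sum can be scaled back to the required size.
-/

/-! ### Young functions -/

namespace IsYoungFunction

variable {A : ℝ≥0 → ℝ≥0∞}

lemma map_mul_le (hA : IsYoungFunction A) {θ : ℝ≥0} (hθ : θ ≤ 1) (t : ℝ≥0) :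
    A (θ * t) ≤ θ * A t := by
  have h := hA.convex.2 (mem_univ t) (mem_univ (0 : ℝ≥0)) (zero_le (a := θ))
    (zero_le (a := 1 - θ)) (add_tsub_cancel_of_le hθ)
  simpa [hA.map_zero, ENNReal.smul_def] using h

protected lemma monotone (hA : IsYoungFunction A) : Monotone A := by
  intro a b hab
  rcases eq_or_ne b 0 with rfl | hb
  · simp_all
  have h1 : a / b ≤ 1 := div_le_one_of_le₀ hab zero_le
  have h := hA.map_mul_le h1 b
  rw [div_mul_cancel₀ a hb] at h
  refine h.trans ?_
  calc ((a / b : ℝ≥0) : ℝ≥0∞) * A b ≤ 1 * A b := by gcongr; exact_mod_cast h1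
    _ = A b := one_mul _

/-- Jensen's inequality with weights of sum at most one, which is available since `A 0 = 0`. -/
lemma map_sum_le (hA : IsYoungFunction A) {ι : Type*} (t : Finset ι) (w a : ι → ℝ≥0)
    (hw : ∑ i ∈ t, w i ≤ 1) : A (∑ i ∈ t, w i * a i) ≤ ∑ i ∈ t, w i * A (a i) := by
  classical
  induction t using Finset.induction_on generalizing w with
  | empty => simp [hA.map_zero]
  | insert i t hi ih =>
    rw [Finset.sum_insert hi] at hw ⊢
    rw [Finset.sum_insert hi]
    set S := ∑ j ∈ t, w j with hS
    rcases eq_or_ne S 0 with h0 | h0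
    · have hz : ∀ j ∈ t, w j = 0 := by
        intro j hj
        exact le_antisymm ((Finset.single_le_sum (fun _ _ => zero_le) hj).trans h0.le) zero_le
      rw [Finset.sum_eq_zero (fun j hj => by simp [hz j hj]),
        Finset.sum_eq_zero (fun j hj => by simp [hz j hj]), add_zero, add_zero]
      exact hA.map_mul_le (by simpa [h0] using hw) _
    · have h1 : ∑ j ∈ t, w j / S ≤ 1 := by
        rw [← Finset.sum_div, ← hS, div_self h0]
      have h2 := ih (fun j => w j / S) h1
      have hSw : S ≤ 1 - w i := by
        rw [← add_tsub_cancel_left (w i) S]; exact tsub_le_tsub_right hw _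
      have hwi : w i ≤ 1 := le_self_add.trans hw
      have h3 := hA.convex.2 (mem_univ (a i))
        (mem_univ ((S / (1 - w i)) * ∑ j ∈ t, w j / S * a j)) (zero_le (a := w i))
        (zero_le (a := 1 - w i)) (add_tsub_cancel_of_le hwi)
      have hne : 1 - w i ≠ 0 := fun h => h0 (le_antisymm (h ▸ hSw) zero_le)
      have h4 : (1 - w i) • ((S / (1 - w i)) * ∑ j ∈ t, w j / S * a j) = ∑ j ∈ t, w j * a j := by
        rw [smul_eq_mul, ← mul_assoc, mul_div_cancel₀ _ hne, Finset.mul_sum]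
        refine Finset.sum_congr rfl fun j _ => ?_
        rw [← mul_assoc, mul_div_cancel₀ _ h0]
      rw [h4, smul_eq_mul] at h3
      refine h3.trans ?_
      rw [ENNReal.smul_def, ENNReal.smul_def, smul_eq_mul, smul_eq_mul]
      refine add_le_add le_rfl ?_
      have h5 := hA.map_mul_le (div_le_one_of_le₀ hSw zero_le) (∑ j ∈ t, w j / S * a j)
      calc ((1 - w i : ℝ≥0) : ℝ≥0∞) * A ((S / (1 - w i)) * ∑ j ∈ t, w j / S * a j)
          ≤ ((1 - w i : ℝ≥0) : ℝ≥0∞) * (((S / (1 - w i) : ℝ≥0) : ℝ≥0∞) *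
              ∑ j ∈ t, ((w j / S : ℝ≥0) : ℝ≥0∞) * A (a j)) := by
            gcongr; exact h5.trans (by gcongr)
        _ = ∑ j ∈ t, (w j : ℝ≥0∞) * A (a j) := by
            rw [← mul_assoc, ← ENNReal.coe_mul, mul_div_cancel₀ _ hne, Finset.mul_sum]
            refine Finset.sum_congr rfl fun j _ => ?_
            rw [← mul_assoc, ← ENNReal.coe_mul, mul_div_cancel₀ _ h0]

/-- A Young function is not identically infinite on `(0,∞)`. -/
lemma exists_pos_ne_top (hA : IsYoungFunction A) : ∃ a : ℝ≥0, 0 < a ∧ A a ≠ ∞ := by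
  obtain ⟨a, b, ha, hb, hab⟩ := hA.nonconst
  by_contra! h
  exact hab ((h a ha).trans (h b hb).symm)

/-! ### Dyadic form of the integral condition -/

/-- Supercritical case: a single large scale suffices, since `A` grows at most linearly near `0`. -/
lemma exists_dyadic_sum_ge_of_lt (hA : IsYoungFunction A) {n : ℕ} {γ : ℝ} (hγ : n < γ)
    (b ε : ℝ≥0) (hε : 0 < ε) :
    ∃ (N : ℕ) (a : ℕ → ℝ≥0), ∑ j ∈ Finset.range N, (2 : ℝ≥0∞) ^ (n * j) * A (a j) ≤ ε ∧
      b ≤ ∑ j ∈ Finset.range N, (2 : ℝ≥0) ^ (γ * j) * a j := by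
  obtain ⟨t, ht, hAt⟩ := hA.exists_pos_ne_top
  obtain ⟨C, hC⟩ := WithTop.ne_top_iff_exists.1 hAt
  set q : ℝ≥0 := (2 : ℝ≥0) ^ ((n : ℝ) - γ) with hq
  have hq1 : q < 1 := NNReal.rpow_lt_one_of_one_lt_of_neg (by norm_num) (by linarith)
  obtain ⟨J, hJ⟩ : ∃ J : ℕ, q ^ J * (b / t * (C + 1)) < min ε 1 := by
    have h1 := (NNReal.tendsto_pow_atTop_nhds_zero_of_lt_one hq1).mul_const (b / t * (C + 1))
    rw [zero_mul] at h1
    exact (h1.eventually (gt_mem_nhds (lt_min hε one_pos))).exists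
  have hqJ : q ^ J = (2 : ℝ≥0) ^ (n * J) * (2 : ℝ≥0) ^ (-(γ * J)) := by
    rw [hq, ← NNReal.rpow_natCast, ← NNReal.rpow_mul, ← NNReal.rpow_natCast,
      ← NNReal.rpow_add (by norm_num)]
    congr 1; push_cast; ring
  -- the value `θ t = b 2 ^ (-γ J)` makes the single weighted term equal to `b`
  set θ : ℝ≥0 := b / t * (2 : ℝ≥0) ^ (-(γ * J)) with hθ
  have hθq : (2 : ℝ≥0) ^ (n * J) * (θ * (C + 1)) < min ε 1 := by
    rw [hqJ] at hJ
    refine lt_of_eq_of_lt ?_ hJ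
    rw [hθ]; ring
  have hθ1 : θ ≤ 1 := by
    refine le_trans ?_ (hθq.le.trans (min_le_right _ _))
    calc θ = 1 * (θ * 1) := by ring
      _ ≤ (2 : ℝ≥0) ^ (n * J) * (θ * (C + 1)) := by
        gcongr
        · exact one_le_pow₀ (by norm_num)
        · exact le_add_self
  refine ⟨J + 1, fun j => if j = J then θ * t else 0, ?_, ?_⟩
  · rw [Finset.sum_eq_single J (fun j _ hj => by simp [hj, hA.map_zero]) (by simp)]
    simp only [if_true]
    calc (2 : ℝ≥0∞) ^ (n * J) * A (θ * t) ≤ (2 : ℝ≥0∞) ^ (n * J) * (θ * A t) := by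
          gcongr; exact hA.map_mul_le hθ1 t
      _ = (((2 : ℝ≥0) ^ (n * J) * (θ * C) : ℝ≥0) : ℝ≥0∞) := by rw [← hC]; push_cast; rfl
      _ ≤ (((2 : ℝ≥0) ^ (n * J) * (θ * (C + 1)) : ℝ≥0) : ℝ≥0∞) := by gcongr; exact le_self_add
      _ ≤ ε := by exact_mod_cast hθq.le.trans (min_le_left _ _)
  · rw [Finset.sum_eq_single J (fun j _ hj => by simp [hj]) (by simp)]
    simp only [if_true]
    rw [hθ]
    have h2 : (2 : ℝ≥0) ^ (γ * J) * (2 : ℝ≥0) ^ (-(γ * J)) = 1 := by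
      rw [← NNReal.rpow_add (by norm_num), add_neg_cancel, NNReal.rpow_zero]
    calc b = b / t * t * ((2 : ℝ≥0) ^ (γ * J) * (2 : ℝ≥0) ^ (-(γ * J))) := by
          rw [h2, div_mul_cancel₀ _ ht.ne', mul_one]
      _ ≤ _ := le_of_eq (by ring)

/-- The set of `t ∈ (0, 1)` with `A t / t ≤ q`, written without division. -/
def slopeSet (A : ℝ≥0 → ℝ≥0∞) (q : ℝ≥0) : Set ℝ :=
  {t | t ∈ Ioo (0 : ℝ) 1 ∧ A t.toNNReal ≤ q * ENNReal.ofReal t}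

/-- Since `A t / t` is nondecreasing, its sublevel sets are initial intervals. -/
lemma map_le_of_mem_slopeSet (hA : IsYoungFunction A) {q : ℝ≥0} {t : ℝ} (ht : t ∈ slopeSet A q)
    {a : ℝ≥0} (ha : (a : ℝ) ≤ t) : A a ≤ q * a := by
  obtain ⟨⟨h0, -⟩, h⟩ := ht
  have h0' : 0 < t.toNNReal := Real.toNNReal_pos.2 h0
  have hat : a ≤ t.toNNReal := NNReal.le_toNNReal_of_coe_le ha
  have h1 := hA.map_mul_le (div_le_one_of_le₀ hat zero_le) t.toNNReal
  rw [div_mul_cancel₀ _ h0'.ne'] at h1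
  refine h1.trans ?_
  calc ((a / t.toNNReal : ℝ≥0) : ℝ≥0∞) * A t.toNNReal
      ≤ ((a / t.toNNReal : ℝ≥0) : ℝ≥0∞) * (q * ENNReal.ofReal t) := by gcongr
    _ = ((q * (a / t.toNNReal * t.toNNReal) : ℝ≥0) : ℝ≥0∞) := by
        rw [ENNReal.ofReal]; push_cast; ring
    _ = q * a := by rw [div_mul_cancel₀ _ h0'.ne']; push_cast; rfl

lemma measurableSet_slopeSet (hA : IsYoungFunction A) (q : ℝ≥0) :
    MeasurableSet (slopeSet A q) := by
  refine Set.OrdConnected.measurableSet ⟨fun x hx y hy z hz => ?_⟩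
  have hz0 : 0 < z := hx.1.1.trans_le hz.1
  refine ⟨⟨hz0, hz.2.trans_lt hy.1.2⟩, ?_⟩
  exact hA.map_le_of_mem_slopeSet hy (a := z.toNNReal)
    (by rw [Real.coe_toNNReal _ hz0.le]; exact hz.2)

lemma volume_slopeSet_le_one (q : ℝ≥0) : volume (slopeSet A q) ≤ 1 :=
  (measure_mono fun _ ht => ht.1).trans (by simp : volume (Ioo (0 : ℝ) 1) ≤ 1)

/-- The sublevel set is an initial interval, whose end point may or may not belong to it. Half of
its length avoids that question. -/
lemma map_half_volume_slopeSet_le (hA : IsYoungFunction A) (q : ℝ≥0) :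
    A ((volume (slopeSet A q)).toNNReal / 2) ≤
      q * ((volume (slopeSet A q)).toNNReal / 2 : ℝ≥0) := by
  set d := (volume (slopeSet A q)).toNNReal with hd
  rcases eq_or_ne d 0 with h0 | h0
  · simp [h0, hA.map_zero]
  have hdv : (d : ℝ≥0∞) = volume (slopeSet A q) :=
    ENNReal.coe_toNNReal ((volume_slopeSet_le_one q).trans_lt ENNReal.one_lt_top).ne
  obtain ⟨t, ht, hat⟩ : ∃ t ∈ slopeSet A q, ((d / 2 : ℝ≥0) : ℝ) ≤ t := by
    by_contra! h
    have h1 : volume (slopeSet A q) ≤ volume (Ioo (0 : ℝ) ((d / 2 : ℝ≥0) : ℝ)) :=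
      measure_mono fun t ht => ⟨ht.1.1, h t ht⟩
    rw [Real.volume_Ioo, sub_zero, ENNReal.ofReal_coe_nnreal, ← hdv, ENNReal.coe_le_coe] at h1
    exact absurd h1 (not_le.2 (NNReal.half_lt_self h0))
  exact hA.map_le_of_mem_slopeSet ht hat

/-- Off the sublevel set, `t / A t` is less than the inverse of the level. -/
lemma div_rpow_le_of_notMem_slopeSet {q : ℝ≥0} (hq : 0 < q) {p t : ℝ} (hp : 0 ≤ p)
    (ht : t ∈ Ioo (0 : ℝ) 1) (h : t ∉ slopeSet A q) :
    (ENNReal.ofReal t / A t.toNNReal) ^ p ≤ (((q⁻¹) ^ p : ℝ≥0) : ℝ≥0∞) := by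
  rw [ENNReal.coe_rpow_of_nonneg _ hp]
  refine ENNReal.rpow_le_rpow ?_ hp
  have h1 : q * ENNReal.ofReal t < A t.toNNReal := by
    by_contra! h2; exact h ⟨ht, h2⟩
  refine ENNReal.div_le_of_le_mul ?_
  calc ENNReal.ofReal t = ((q⁻¹ : ℝ≥0) : ℝ≥0∞) * (q * ENNReal.ofReal t) := by
        rw [← mul_assoc, ← ENNReal.coe_mul, inv_mul_cancel₀ hq.ne', ENNReal.coe_one, one_mul]
    _ ≤ _ := by gcongr

/-- Dyadic form of the divergence of the integral of `(t / A t) ^ (γ / (n - γ))`: the level sets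
of `A t / t` at the levels `η 2 ^ (-(n - γ) j)` have non-summable weighted lengths. -/
lemma tsum_volume_slopeSet_eq_top (hA : IsYoungFunction A) {n : ℕ} {γ : ℝ} (hγ : 0 < γ)
    (hγn : γ < n)
    (hI : ∫⁻ t in Ioo (0 : ℝ) 1, (ENNReal.ofReal t / A t.toNNReal) ^ (γ / (n - γ)) = ∞)
    {η : ℝ≥0} (hη : 0 < η) :
    ∑' j : ℕ, (((2 : ℝ≥0) ^ (γ * j) : ℝ≥0) : ℝ≥0∞) *
      volume (slopeSet A (η * (2 : ℝ≥0) ^ (-((n - γ) * j)))) = ∞ := by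
  set p := γ / (n - γ) with hp
  have hp0 : 0 < p := div_pos hγ (by linarith)
  set Q : ℕ → ℝ≥0 := fun j => η * (2 : ℝ≥0) ^ (-((n - γ) * j)) with hQ
  have hQ0 : ∀ j, 0 < Q j := fun j => mul_pos hη (NNReal.rpow_pos (by norm_num))
  have hQp : ∀ j, ((Q j)⁻¹) ^ p = η⁻¹ ^ p * (2 : ℝ≥0) ^ (γ * j) := by
    intro j
    have h3 : ((n - γ) * j) * p = γ * j := by
      rw [hp]; field_simp [show (n : ℝ) - γ ≠ 0 by linarith]
    rw [hQ]
    simp only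
    rw [mul_inv, NNReal.mul_rpow, ← NNReal.rpow_neg, neg_neg, ← NNReal.rpow_mul, h3]
  set C : ℝ≥0 := η⁻¹ ^ p * (2 : ℝ≥0) ^ γ with hC
  have hC0 : C ≠ 0 := by
    refine (mul_pos (NNReal.rpow_pos (by positivity)) (NNReal.rpow_pos (by norm_num))).ne'
  have h2γ : (1 : ℝ≥0) ≤ (2 : ℝ≥0) ^ γ := NNReal.one_le_rpow (by norm_num) hγ.le
  -- the integrand is compared with the last level whose sublevel set contains `t`
  have hpt : ∀ t ∈ Ioo (0 : ℝ) 1, (ENNReal.ofReal t / A t.toNNReal) ^ p ≤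
      C * (1 + ∑' j : ℕ, (((2 : ℝ≥0) ^ (γ * j) : ℝ≥0) : ℝ≥0∞) *
        (slopeSet A (Q j)).indicator 1 t) := by
    intro t ht
    by_cases hall : ∀ j, t ∈ slopeSet A (Q j)
    · have : ∑' j : ℕ, (((2 : ℝ≥0) ^ (γ * j) : ℝ≥0) : ℝ≥0∞) *
          (slopeSet A (Q j)).indicator 1 t = ∞ := by
        refine top_le_iff.1 ?_
        calc (∞ : ℝ≥0∞) = ∑' _ : ℕ, (1 : ℝ≥0∞) := by
              rw [ENNReal.tsum_const_eq_top_of_ne_zero one_ne_zero]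
          _ ≤ _ := ENNReal.tsum_le_tsum fun j => by
              rw [indicator_of_mem (hall j), Pi.one_apply, mul_one]
              exact_mod_cast NNReal.one_le_rpow (by norm_num) (by positivity)
      rw [this, add_top, ENNReal.mul_top (by exact_mod_cast hC0)]
      exact le_top
    · push Not at hall
      classical
      obtain ⟨hj, hmin⟩ := And.intro (Nat.find_spec hall) (fun i => Nat.find_min hall (m := i))
      refine (div_rpow_le_of_notMem_slopeSet (hQ0 _) hp0.le ht hj).trans ?_
      rcases hcase : Nat.find hall with _ | i
      · rw [hQp]
        simp only [Nat.cast_zero, mul_zero, NNReal.rpow_zero, mul_one]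
        calc ((η⁻¹ ^ p : ℝ≥0) : ℝ≥0∞) ≤ C := by
              rw [hC]; exact_mod_cast le_mul_of_one_le_right zero_le h2γ
          _ ≤ C * (1 + _) := le_mul_of_one_le_right zero_le le_self_add
      · have hi : t ∈ slopeSet A (Q i) := not_not.1 (hmin i (by omega))
        rw [hQp]
        calc ((η⁻¹ ^ p * (2 : ℝ≥0) ^ (γ * (i + 1 : ℕ)) : ℝ≥0) : ℝ≥0∞)
            = C * (((2 : ℝ≥0) ^ (γ * i) : ℝ≥0) : ℝ≥0∞) := by
              rw [hC, ← ENNReal.coe_mul, mul_assoc, ← NNReal.rpow_add (by norm_num)]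
              congr 3; push_cast; ring
          _ ≤ C * (1 + ∑' j : ℕ, (((2 : ℝ≥0) ^ (γ * j) : ℝ≥0) : ℝ≥0∞) *
                (slopeSet A (Q j)).indicator 1 t) := by
              gcongr
              refine le_trans ?_ le_add_self
              refine le_trans ?_ (ENNReal.le_tsum i)
              rw [indicator_of_mem hi, Pi.one_apply, mul_one]
  have hint : ∞ ≤ C * (1 + ∑' j : ℕ, (((2 : ℝ≥0) ^ (γ * j) : ℝ≥0) : ℝ≥0∞) *
      volume (slopeSet A (Q j))) := by
    have hm : ∀ j : ℕ, Measurable fun t : ℝ => (((2 : ℝ≥0) ^ (γ * j) : ℝ≥0) : ℝ≥0∞) *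
        (slopeSet A (Q j)).indicator (1 : ℝ → ℝ≥0∞) t := fun j =>
      (measurable_one.indicator (hA.measurableSet_slopeSet _)).const_mul _
    rw [← hI]
    refine (setLIntegral_mono' measurableSet_Ioo hpt).trans ?_
    rw [lintegral_const_mul' _ _ ENNReal.coe_ne_top, lintegral_add_left measurable_const,
      lintegral_tsum (fun j => (hm j).aemeasurable)]
    gcongr with j
    · simp
    · rw [lintegral_const_mul' _ _ ENNReal.coe_ne_top,
        lintegral_indicator_one (hA.measurableSet_slopeSet _)]
      gcongr
      exact Measure.restrict_le_self
  by_contra hne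
  exact absurd (top_le_iff.1 hint)
    (ENNReal.mul_ne_top ENNReal.coe_ne_top (ENNReal.add_ne_top.2 ⟨ENNReal.one_ne_top, hne⟩))

/-- Subcritical case: divergence of the integral yields sequences spread over many scales. -/
lemma exists_dyadic_sum_ge_of_lintegral_eq_top (hA : IsYoungFunction A) {n : ℕ} {γ : ℝ}
    (hγ : 0 < γ) (hγn : γ < n)
    (hI : ∫⁻ t in Ioo (0 : ℝ) 1, (ENNReal.ofReal t / A t.toNNReal) ^ (γ / (n - γ)) = ∞)
    (b ε : ℝ≥0) (hε : 0 < ε) :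
    ∃ (N : ℕ) (a : ℕ → ℝ≥0), ∑ j ∈ Finset.range N, (2 : ℝ≥0∞) ^ (n * j) * A (a j) ≤ ε ∧
      b ≤ ∑ j ∈ Finset.range N, (2 : ℝ≥0) ^ (γ * j) * a j := by
  rcases eq_or_ne b 0 with rfl | hb
  · exact ⟨0, 0, by simp, by simp⟩
  -- with this slope, a weighted sum equal to `b` costs at most `η b = ε`
  set η : ℝ≥0 := ε / b with hη
  have hη0 : 0 < η := div_pos hε (pos_iff_ne_zero.2 hb)
  set Q : ℕ → ℝ≥0 := fun j => η * (2 : ℝ≥0) ^ (-((n - γ) * j)) with hQ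
  set a : ℕ → ℝ≥0 := fun j => (volume (slopeSet A (Q j))).toNNReal / 2 with ha
  have hAa : ∀ j, A (a j) ≤ Q j * a j := fun j => hA.map_half_volume_slopeSet_le (Q j)
  have hsum : ∑' j : ℕ, (((2 : ℝ≥0) ^ (γ * j) * a j : ℝ≥0) : ℝ≥0∞) = ∞ := by
    have h1 := hA.tsum_volume_slopeSet_eq_top hγ hγn hI hη0
    have h2 : ∀ j : ℕ, (((2 : ℝ≥0) ^ (γ * j) * a j : ℝ≥0) : ℝ≥0∞) =
        (((2 : ℝ≥0) ^ (γ * j) : ℝ≥0) : ℝ≥0∞) * volume (slopeSet A (Q j)) * 2⁻¹ := by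
      intro j
      rw [ha, ENNReal.coe_mul, ENNReal.coe_div two_ne_zero, ENNReal.coe_toNNReal
        ((volume_slopeSet_le_one (Q j)).trans_lt ENNReal.one_lt_top).ne, mul_assoc]
      rfl
    simp_rw [h2]
    rw [ENNReal.tsum_mul_right, h1, ENNReal.top_mul (by simp)]
  obtain ⟨N, hN⟩ : ∃ N : ℕ, b ≤ ∑ j ∈ Finset.range N, (2 : ℝ≥0) ^ (γ * j) * a j := by
    have h1 : (b : ℝ≥0∞) < ∑' j : ℕ, (((2 : ℝ≥0) ^ (γ * j) * a j : ℝ≥0) : ℝ≥0∞) := by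
      rw [hsum]; exact ENNReal.coe_lt_top
    rw [ENNReal.tsum_eq_iSup_nat, lt_iSup_iff] at h1
    obtain ⟨N, hN⟩ := h1
    exact ⟨N, by exact_mod_cast hN.le⟩
  set S := ∑ j ∈ Finset.range N, (2 : ℝ≥0) ^ (γ * j) * a j with hS
  have hS0 : S ≠ 0 := fun h => hb (le_antisymm (h ▸ hN) zero_le)
  -- the weighted sum may overshoot `b`; it is scaled back
  refine ⟨N, fun j => b / S * a j, ?_, le_of_eq ?_⟩
  · calc ∑ j ∈ Finset.range N, (2 : ℝ≥0∞) ^ (n * j) * A (b / S * a j)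
        ≤ ∑ j ∈ Finset.range N, (((b / S) * (η * ((2 : ℝ≥0) ^ (γ * j) * a j)) : ℝ≥0) : ℝ≥0∞) := by
          refine Finset.sum_le_sum fun j _ => ?_
          have h1 : A (b / S * a j) ≤ ((b / S * (Q j * a j) : ℝ≥0) : ℝ≥0∞) := by
            refine (hA.map_mul_le (div_le_one_of_le₀ hN zero_le) _).trans ?_
            push_cast
            gcongr
            exact hAa j
          have h2 : (2 : ℝ≥0) ^ (n * j) * (2 : ℝ≥0) ^ (-((n - γ) * j)) = (2 : ℝ≥0) ^ (γ * j) := by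
            rw [← NNReal.rpow_natCast, ← NNReal.rpow_add (by norm_num)]
            congr 1; push_cast; ring
          calc (2 : ℝ≥0∞) ^ (n * j) * A (b / S * a j)
              ≤ (((2 : ℝ≥0) ^ (n * j) : ℝ≥0) : ℝ≥0∞) * ((b / S * (Q j * a j) : ℝ≥0) : ℝ≥0∞) := by
                push_cast at h1 ⊢
                gcongr
            _ = _ := by
                rw [← ENNReal.coe_mul, ← h2, hQ]
                congr 1; ring
      _ = ((b / S * (η * S) : ℝ≥0) : ℝ≥0∞) := by
          rw [← ENNReal.ofNNReal_finsetSum, ← Finset.mul_sum, ← Finset.mul_sum]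
      _ ≤ ε := by
          rw [hη]
          refine le_of_eq ?_
          congr 1
          field_simp
  · calc b = b / S * S := (div_mul_cancel₀ _ hS0).symm
      _ = _ := by
        rw [hS, Finset.mul_sum]
        exact Finset.sum_congr rfl fun j _ => by ring

end IsYoungFunction

/-! ### Iterated derivatives and integration by parts -/

section

variable {E : Type*} [NormedAddCommGroup E] [NormedSpace ℝ E]

lemma contDiff_fderiv_apply {f : E → ℝ} (hf : ContDiff ℝ (⊤ : ℕ∞) f) (v : E) :
    ContDiff ℝ (⊤ : ℕ∞) fun x => fderiv ℝ f x v :=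
  (hf.fderiv_right (m := (⊤ : ℕ∞)) (by simp)).clm_apply contDiff_const

lemma contDiff_iteratedFDeriv_apply {f : E → ℝ} (hf : ContDiff ℝ (⊤ : ℕ∞) f) (h : ℕ)
    (v : Fin h → E) : ContDiff ℝ (⊤ : ℕ∞) fun x => iteratedFDeriv ℝ h f x v := by
  have h1 : ContDiff ℝ (⊤ : ℕ∞) (iteratedFDeriv ℝ h f) :=
    hf.iteratedFDeriv_right (by exact_mod_cast le_top)
  exact (ContinuousMultilinearMap.apply ℝ (fun _ : Fin h => E) ℝ v).contDiff.comp h1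

lemma HasCompactSupport.iteratedFDeriv_apply {f : E → ℝ} (hf : HasCompactSupport f) (h : ℕ)
    (v : Fin h → E) : HasCompactSupport fun x => _root_.iteratedFDeriv ℝ h f x v :=
  (hf.iteratedFDeriv (𝕜 := ℝ) h).comp_left
    (g := fun L : ContinuousMultilinearMap ℝ (fun _ : Fin h => E) ℝ => L v) rfl

lemma iteratedFDeriv_succ_apply_eq_fderiv {f : E → ℝ} (hf : ContDiff ℝ (⊤ : ℕ∞) f) (h : ℕ)
    (v : Fin (h + 1) → E) (x : E) :
    iteratedFDeriv ℝ (h + 1) f x v =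
      fderiv ℝ (fun y => iteratedFDeriv ℝ h f y (Fin.tail v)) x (v 0) := by
  rw [iteratedFDeriv_succ_apply_left]
  have h1 : DifferentiableAt ℝ (iteratedFDeriv ℝ h f) x :=
    (hf.differentiable_iteratedFDeriv (m := h) (by exact_mod_cast WithTop.coe_lt_top h)) x
  have := ((ContinuousMultilinearMap.apply ℝ (fun _ : Fin h => E) ℝ
    (Fin.tail v)).hasFDerivAt.comp x h1.hasFDerivAt).fderiv
  rw [show (fun y => iteratedFDeriv ℝ h f y (Fin.tail v)) =
    (ContinuousMultilinearMap.apply ℝ (fun _ : Fin h => E) ℝ (Fin.tail v)) ∘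
      iteratedFDeriv ℝ h f from rfl, this]
  rfl

lemma fderiv_fderiv_apply_comm {f : E → ℝ} (hf : ContDiff ℝ (⊤ : ℕ∞) f) (v w x : E) :
    fderiv ℝ (fun y => fderiv ℝ f y v) x w = fderiv ℝ (fun y => fderiv ℝ f y w) x v := by
  have hd : DifferentiableAt ℝ (fderiv ℝ f) x :=
    (hf.fderiv_right (m := (⊤ : ℕ∞)) (by simp)).differentiable (by simp) x
  rw [fderiv_clm_apply hd (differentiableAt_const v),
    fderiv_clm_apply hd (differentiableAt_const w)]
  have := (hf.contDiffAt (x := x)).isSymmSndFDerivAt (by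
    rw [minSmoothness_of_isRCLikeNormedField]; exact WithTop.coe_le_coe.2 le_top)
  simpa using this w v

/-- Directional derivatives commute with iterated derivatives of a smooth function. -/
lemma fderiv_iteratedFDeriv_apply_comm {f : E → ℝ} (hf : ContDiff ℝ (⊤ : ℕ∞) f) (h : ℕ)
    (v : Fin h → E) (w x : E) :
    fderiv ℝ (fun y => iteratedFDeriv ℝ h f y v) x w =
      iteratedFDeriv ℝ h (fun y => fderiv ℝ f y w) x v := by
  induction h generalizing x w with
  | zero => simp
  | succ h ih =>
    rw [iteratedFDeriv_succ_apply_eq_fderiv (contDiff_fderiv_apply hf w)]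
    simp_rw [iteratedFDeriv_succ_apply_eq_fderiv hf, ← ih]
    exact fderiv_fderiv_apply_comm (contDiff_iteratedFDeriv_apply hf h _) _ _ _

/-- Integration by parts of order `h` for smooth functions, one of them compactly supported. -/
lemma integral_mul_iteratedFDeriv_apply [FiniteDimensional ℝ E] [MeasurableSpace E] [BorelSpace E]
    (μ : Measure E) [μ.IsAddHaarMeasure] (h : ℕ) (v : Fin h → E) {u η : E → ℝ}
    (hu : ContDiff ℝ (⊤ : ℕ∞) u) (hη : ContDiff ℝ (⊤ : ℕ∞) η) (hηc : HasCompactSupport η) :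
    ∫ x, u x * iteratedFDeriv ℝ h η x v ∂μ =
      (-1 : ℝ) ^ h * ∫ x, iteratedFDeriv ℝ h u x v * η x ∂μ := by
  induction h generalizing u with
  | zero => simp
  | succ h ih =>
    have hg := contDiff_iteratedFDeriv_apply hη h (Fin.tail v)
    have hgc := hηc.iteratedFDeriv_apply h (Fin.tail v)
    have hu' := contDiff_fderiv_apply hu (v 0)
    simp_rw [iteratedFDeriv_succ_apply_eq_fderiv hη]
    rw [integral_mul_fderiv_eq_neg_fderiv_mul_of_integrable, ih (Fin.tail v) hu']
    · rw [pow_succ, mul_neg_one, neg_mul]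
      congr! 4 with x
      rw [← fderiv_iteratedFDeriv_apply_comm hu, ← iteratedFDeriv_succ_apply_eq_fderiv hu]
    · exact (hu'.continuous.mul hg.continuous).integrable_of_hasCompactSupport hgc.mul_left
    · refine (hu.continuous.mul
        (contDiff_fderiv_apply hg (v 0)).continuous).integrable_of_hasCompactSupport ?_
      exact (hgc.fderiv_apply (𝕜 := ℝ) (v 0)).mul_left
    · exact (hu.continuous.mul hg.continuous).integrable_of_hasCompactSupport hgc.mul_left
    · exact fun x _ => hu.differentiable (by simp) x
    · exact fun x _ => hg.differentiable (by simp) x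

end

section

variable {n : ℕ}

/-! ### Weak gradients of smooth functions -/

lemma contDiff_classicalGrad {u : EuclideanSpace ℝ (Fin n) → ℝ} (hu : ContDiff ℝ (⊤ : ℕ∞) u)
    (h : ℕ) : ContDiff ℝ (⊤ : ℕ∞) (classicalGrad h u) :=
  contDiff_euclidean.2 fun _ => contDiff_iteratedFDeriv_apply hu h _

lemma hasCompactSupport_classicalGrad {u : EuclideanSpace ℝ (Fin n) → ℝ}
    (hu : HasCompactSupport u) (h : ℕ) : HasCompactSupport (classicalGrad h u) := by
  refine (hu.iteratedFDeriv (𝕜 := ℝ) h).mono fun x hx => ?_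
  contrapose! hx
  simp only [Function.mem_support, not_not] at hx ⊢
  ext i
  simp [classicalGrad, hx]

lemma isWeakGrad_classicalGrad {u : EuclideanSpace ℝ (Fin n) → ℝ}
    (hu : ContDiff ℝ (⊤ : ℕ∞) u) (h : ℕ) :
    IsWeakGrad h u (classicalGrad h u) where
  locallyIntegrable := hu.continuous.locallyIntegrable
  locallyIntegrable_grad := (contDiff_classicalGrad hu h).continuous.locallyIntegrable
  integral_eq _ hη hηc _ := integral_mul_iteratedFDeriv_apply volume h _ hu hη hηc

lemma locallyIntegrable_euclidean_apply {ι : Type*} [Fintype ι]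
    {g : EuclideanSpace ℝ (Fin n) → EuclideanSpace ℝ ι} (hg : LocallyIntegrable g volume) (i : ι) :
    LocallyIntegrable (fun x => g x i) volume := fun x => by
  obtain ⟨U, hU, hi⟩ := hg x
  exact ⟨U, hU, (EuclideanSpace.proj i : EuclideanSpace ℝ ι →L[ℝ] ℝ).integrable_comp hi⟩

/-- Weak gradients are unique up to null sets. -/
lemma IsWeakGrad.ae_eq {h : ℕ} {u : EuclideanSpace ℝ (Fin n) → ℝ}
    {g g' : EuclideanSpace ℝ (Fin n) → EuclideanSpace ℝ (Fin h → Fin n)}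
    (hg : IsWeakGrad h u g) (hg' : IsWeakGrad h u g') : g =ᵐ[volume] g' := by
  have key : ∀ i, ∀ᵐ x, g x i = g' x i := fun i => by
    refine ae_eq_of_integral_contDiff_smul_eq
      (locallyIntegrable_euclidean_apply hg.locallyIntegrable_grad i)
      (locallyIntegrable_euclidean_apply hg'.locallyIntegrable_grad i) fun η hη hηc => ?_
    have h1 := (hg.integral_eq η hη hηc i).symm.trans (hg'.integral_eq η hη hηc i)
    simpa [mul_comm] using h1
  filter_upwards [ae_all_iff.2 key] with x hx
  ext i
  exact hx i

lemma weakGrad_ae_eq_classicalGrad {u : EuclideanSpace ℝ (Fin n) → ℝ}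
    (hu : ContDiff ℝ (⊤ : ℕ∞) u) (h : ℕ) :
    weakGrad h u =ᵐ[volume] classicalGrad h u := by
  have H : ∃ g, IsWeakGrad h u g := ⟨_, isWeakGrad_classicalGrad hu h⟩
  rw [weakGrad, dif_pos H]
  exact H.choose_spec.ae_eq (isWeakGrad_classicalGrad hu h)

end

/-! ### Modulars of dyadic superpositions -/

/-- The weight `min (t ^ (-σ)) (t ^ (1 - σ))`: up to a constant, it bounds
`|Γ (x / R) - Γ (y / R)| (R / |x - y|) ^ σ` with `t = |x - y| / R` if `Γ` is bounded and
Lipschitz. It vanishes at `0` for `0 < σ < 1`. -/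
noncomputable def dyadicWeight (σ : ℝ) (t : ℝ≥0) : ℝ≥0 := min (t ^ (-σ)) (t ^ (1 - σ))

lemma measurable_dyadicWeight (σ : ℝ) : Measurable (dyadicWeight σ) := by
  unfold dyadicWeight; fun_prop

lemma NNReal.sum_range_pow_le {q : ℝ≥0} (hq : q < 1) (N : ℕ) :
    ∑ i ∈ Finset.range N, q ^ i ≤ (1 - q)⁻¹ := by
  rw [← NNReal.tsum_geometric hq]
  exact (NNReal.summable_geometric hq).sum_le_tsum _ (fun _ _ => zero_le)

/-- The weights of the dyadic scales at a given distance `r` are summable, uniformly in `r`: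
they decay geometrically in both directions away from the scale `2 ^ j ≈ r`. -/
lemma exists_sum_dyadicWeight_le {σ : ℝ} (h0 : 0 < σ) (h1 : σ < 1) :
    ∃ C : ℝ≥0, 0 < C ∧ ∀ (r : ℝ≥0) (N : ℕ),
      ∑ j ∈ Finset.range N, dyadicWeight σ (r / 2 ^ j) ≤ C := by
  set q : ℝ≥0 := (2 : ℝ≥0) ^ (-σ) with hq
  set q' : ℝ≥0 := (2 : ℝ≥0) ^ (-(1 - σ)) with hq'
  have hq1 : q < 1 := NNReal.rpow_lt_one_of_one_lt_of_neg (by norm_num) (by linarith)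
  have hq1' : q' < 1 := NNReal.rpow_lt_one_of_one_lt_of_neg (by norm_num) (by linarith)
  refine ⟨(1 - q)⁻¹ + (1 - q')⁻¹, add_pos (inv_pos.2 (tsub_pos_of_lt hq1))
    (inv_pos.2 (tsub_pos_of_lt hq1')), fun r N => ?_⟩
  have hex : ∃ J : ℕ, r < 2 ^ J := pow_unbounded_of_one_lt r one_lt_two
  classical
  -- `2 ^ (J - 1) ≤ r < 2 ^ J`, unless `J = 0`
  set J := Nat.find hex with hJ
  have hJr : r < 2 ^ J := Nat.find_spec hex
  have hmin : ∀ i < J, (2 : ℝ≥0) ^ i ≤ r := fun i hi => not_lt.1 (Nat.find_min hex hi)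
  calc ∑ j ∈ Finset.range N, dyadicWeight σ (r / 2 ^ j)
      ≤ ∑ j ∈ Finset.range (J + N), dyadicWeight σ (r / 2 ^ j) :=
        Finset.sum_le_sum_of_subset (Finset.range_mono (Nat.le_add_left _ _))
    _ = ∑ j ∈ Finset.range J, dyadicWeight σ (r / 2 ^ j) +
          ∑ i ∈ Finset.range N, dyadicWeight σ (r / 2 ^ (J + i)) := Finset.sum_range_add _ _ _
    _ ≤ ∑ j ∈ Finset.range J, q ^ (J - 1 - j) + ∑ i ∈ Finset.range N, q' ^ i := by
        refine add_le_add (Finset.sum_le_sum fun j hj => ?_) (Finset.sum_le_sum fun i _ => ?_)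
        · rw [Finset.mem_range] at hj
          refine (min_le_left _ _).trans ?_
          have h2 : (2 : ℝ≥0) ^ (J - 1 - j) ≤ r / 2 ^ j := by
            rw [le_div_iff₀ (by positivity), ← pow_add]
            convert hmin (J - 1) (by omega) using 2
            omega
          calc (r / 2 ^ j) ^ (-σ) ≤ ((2 : ℝ≥0) ^ (J - 1 - j)) ^ (-σ) :=
                NNReal.rpow_le_rpow_of_nonpos (by positivity) h2 (by linarith)
            _ = q ^ (J - 1 - j) := by
                rw [hq, ← NNReal.rpow_natCast, ← NNReal.rpow_mul, mul_comm, NNReal.rpow_mul,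
                  NNReal.rpow_natCast]
        · refine (min_le_right _ _).trans ?_
          have h2 : r / 2 ^ (J + i) ≤ ((2 : ℝ≥0) ^ i)⁻¹ := by
            rw [div_le_iff₀ (by positivity), pow_add, mul_comm, mul_assoc,
              mul_inv_cancel₀ (by positivity), mul_one]
            exact hJr.le
          calc (r / 2 ^ (J + i)) ^ (1 - σ) ≤ (((2 : ℝ≥0) ^ i)⁻¹) ^ (1 - σ) :=
                NNReal.rpow_le_rpow h2 (by linarith)
            _ = q' ^ i := by
                rw [hq', ← NNReal.rpow_natCast, ← NNReal.rpow_neg, ← NNReal.rpow_mul,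
                  ← NNReal.rpow_natCast, ← NNReal.rpow_mul]
                congr 1; ring
    _ ≤ (1 - q)⁻¹ + (1 - q')⁻¹ := by
        rw [Finset.sum_range_reflect (fun i => q ^ i) J]
        exact add_le_add (NNReal.sum_range_pow_le hq1 _) (NNReal.sum_range_pow_le hq1' _)

section

variable {n : ℕ}

/-- The kernel `dyadicWeight σ (|z| / R) / |z| ^ n` at scale `R`. -/
noncomputable def dyadicKernel (σ : ℝ) (R : ℝ≥0) (z : EuclideanSpace ℝ (Fin n)) : ℝ≥0∞ :=
  dyadicWeight σ (‖z‖₊ / R) / ‖z‖ₑ ^ n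

lemma measurable_dyadicKernel (σ : ℝ) (R : ℝ≥0) :
    Measurable (dyadicKernel (n := n) σ R) := by
  unfold dyadicKernel
  have := measurable_dyadicWeight σ
  fun_prop

lemma integrableOn_min_rpow {σ : ℝ} (h0 : 0 < σ) (h1 : σ < 1) :
    IntegrableOn (fun y : ℝ => min (y ^ (-σ - 1)) (y ^ (-σ))) (Ioi 0) := by
  have hm : Measurable fun y : ℝ => min (y ^ (-σ - 1)) (y ^ (-σ)) := by fun_prop
  rw [← Ioc_union_Ioi_eq_Ioi zero_le_one]
  refine IntegrableOn.union ?_ ?_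
  · have h2 : IntegrableOn (fun y : ℝ => y ^ (-σ)) (Ioc 0 1) :=
      (intervalIntegrable_iff_integrableOn_Ioc_of_le zero_le_one).1
        (intervalIntegral.intervalIntegrable_rpow' (by linarith))
    refine h2.mono' hm.aestronglyMeasurable ?_
    filter_upwards [ae_restrict_mem measurableSet_Ioc] with y hy
    have := hy.1.le
    rw [Real.norm_of_nonneg (by positivity)]
    exact min_le_right _ _
  · have h2 : IntegrableOn (fun y : ℝ => y ^ (-σ - 1)) (Ioi 1) :=
      integrableOn_Ioi_rpow_of_lt (by linarith) one_pos
    refine h2.mono' hm.aestronglyMeasurable ?_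
    filter_upwards [ae_restrict_mem measurableSet_Ioi] with y hy
    have : 0 ≤ y := zero_le_one.trans (le_of_lt hy)
    rw [Real.norm_of_nonneg (by positivity)]
    exact min_le_left _ _

/-- The kernel is of order `|z| ^ (1 - σ - n)` near `0` and `|z| ^ (-σ - n)` near infinity. -/
lemma lintegral_dyadicKernel_one_lt_top (hn : 1 ≤ n) {σ : ℝ} (h0 : 0 < σ) (h1 : σ < 1) :
    ∫⁻ z : EuclideanSpace ℝ (Fin n), dyadicKernel σ 1 z < ∞ := by
  have : Nonempty (Fin n) := ⟨⟨0, hn⟩⟩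
  have : Nontrivial (EuclideanSpace ℝ (Fin n)) :=
    Module.nontrivial_of_finrank_pos (R := ℝ) (by rw [finrank_euclideanSpace_fin]; omega)
  set f : ℝ → ℝ := fun t => min (t ^ (-σ)) (t ^ (1 - σ)) / t ^ n with hf
  have hint : Integrable (fun z : EuclideanSpace ℝ (Fin n) => f ‖z‖) volume := by
    rw [integrable_fun_norm_addHaar, finrank_euclideanSpace_fin]
    refine (integrableOn_min_rpow h0 h1).congr_fun (fun y hy => ?_) measurableSet_Ioi
    have hy : 0 < y := hy
    have h3 : y ^ (n - 1) / y ^ n = y⁻¹ := by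
      rw [div_eq_iff (by positivity), ← mul_left_inj' hy.ne', ← pow_succ, Nat.sub_add_cancel hn]
      field_simp
    calc min (y ^ (-σ - 1)) (y ^ (-σ))
        = y⁻¹ * min (y ^ (-σ)) (y ^ (1 - σ)) := by
          rw [mul_min_of_nonneg _ _ (inv_nonneg.2 hy.le), ← Real.rpow_neg_one,
            ← Real.rpow_add hy, ← Real.rpow_add hy]
          congr 2 <;> ring
      _ = _ := by rw [← h3, hf]; simp only [smul_eq_mul]; ring
  refine lt_of_le_of_lt (lintegral_mono fun z => ?_) hint.hasFiniteIntegral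
  rcases eq_or_ne z 0 with rfl | hz
  · simp [dyadicKernel, dyadicWeight, NNReal.zero_rpow (show (1 - σ) ≠ 0 by linarith),
      NNReal.zero_rpow (neg_ne_zero.2 h0.ne')]
  · have hz' : 0 < ‖z‖ := norm_pos_iff.2 hz
    refine le_of_eq ?_
    rw [dyadicKernel, div_one, ← enorm_norm z, ← ofReal_norm,
      ← ofReal_norm, Real.norm_of_nonneg (norm_nonneg _), ← ENNReal.ofReal_pow hz'.le,
      ← ENNReal.ofReal_coe_nnreal, ← ENNReal.ofReal_div_of_pos (by positivity),
      Real.norm_of_nonneg (by positivity)]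
    simp [dyadicWeight, hf]

/-- The integral of the kernel does not depend on the scale. -/
lemma lintegral_dyadicKernel (σ : ℝ) {R : ℝ≥0} (hR : 0 < R) :
    ∫⁻ z : EuclideanSpace ℝ (Fin n), dyadicKernel σ R z =
      ∫⁻ z : EuclideanSpace ℝ (Fin n), dyadicKernel σ 1 z := by
  have hRr : ((R : ℝ)⁻¹) ≠ 0 := by positivity
  have hR0 : (R : ℝ≥0∞) ^ n ≠ 0 := pow_ne_zero _ (by exact_mod_cast hR.ne')
  have hRt : (R : ℝ≥0∞) ^ n ≠ ∞ := ENNReal.pow_ne_top ENNReal.coe_ne_top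
  have h1 : ∀ z : EuclideanSpace ℝ (Fin n),
      dyadicKernel σ 1 ((R : ℝ)⁻¹ • z) = R ^ n * dyadicKernel σ R z := by
    intro z
    have hn1 : ‖(R : ℝ)⁻¹ • z‖₊ = ‖z‖₊ / R := by
      rw [nnnorm_smul, nnnorm_inv, NNReal.nnnorm_eq, mul_comm, div_eq_mul_inv]
    rw [dyadicKernel, dyadicKernel, enorm_eq_nnnorm, hn1, div_one, ENNReal.coe_div hR.ne',
      ← enorm_eq_nnnorm, ENNReal.div_eq_inv_mul, ENNReal.div_eq_inv_mul, ENNReal.div_eq_inv_mul,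
      mul_pow, ← ENNReal.inv_pow, ENNReal.mul_inv (by simp [hRt]) (by simp [hR0]), inv_inv]
    ring
  have h2 : ∫⁻ z : EuclideanSpace ℝ (Fin n), dyadicKernel σ 1 ((R : ℝ)⁻¹ • z) =
      R ^ n * ∫⁻ z : EuclideanSpace ℝ (Fin n), dyadicKernel σ 1 z := by
    rw [← lintegral_map (measurable_dyadicKernel σ 1) (measurable_const_smul _),
      Measure.map_addHaar_smul volume hRr, lintegral_smul_measure, finrank_euclideanSpace_fin]
    congr 1
    rw [inv_pow, inv_inv, abs_of_nonneg (by positivity), ENNReal.ofReal_pow (by positivity),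
      ENNReal.ofReal_coe_nnreal]
  simp_rw [h1] at h2
  rw [lintegral_const_mul _ (measurable_dyadicKernel σ R)] at h2
  exact (ENNReal.mul_right_inj hR0 hRt).1 h2

/-- The kernel integrated over the pairs of points one of which lies in a set `B`. -/
lemma lintegral_lintegral_indicator_mul_sub {k : EuclideanSpace ℝ (Fin n) → ℝ≥0∞}
    (hk : Measurable k) {B : Set (EuclideanSpace ℝ (Fin n))} (hB : MeasurableSet B) :
    ∫⁻ x, ∫⁻ y, (B.indicator 1 x + B.indicator 1 y) * k (x - y) =
      2 * (volume B * ∫⁻ z, k z) := by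
  have hi : Measurable (B.indicator (1 : EuclideanSpace ℝ (Fin n) → ℝ≥0∞)) :=
    measurable_one.indicator hB
  have hkp : Measurable fun p : EuclideanSpace ℝ (Fin n) × EuclideanSpace ℝ (Fin n) =>
      k (p.1 - p.2) := hk.comp (measurable_fst.sub measurable_snd)
  have h1 : ∫⁻ x, ∫⁻ y, B.indicator 1 x * k (x - y) = volume B * ∫⁻ z, k z := by
    have : ∀ x, ∫⁻ y, B.indicator 1 x * k (x - y) = B.indicator 1 x * ∫⁻ z, k z := fun x => by
      rw [lintegral_const_mul _ (by fun_prop), lintegral_sub_left_eq_self]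
    simp_rw [this]
    rw [lintegral_mul_const _ hi, lintegral_indicator_one hB]
  have h2 : ∫⁻ x, ∫⁻ y, B.indicator 1 y * k (x - y) = volume B * ∫⁻ z, k z := by
    rw [lintegral_lintegral_swap ((hi.comp measurable_snd).mul hkp).aemeasurable]
    have : ∀ y, ∫⁻ x, B.indicator 1 y * k (x - y) = B.indicator 1 y * ∫⁻ z, k z := fun y => by
      rw [lintegral_const_mul _ (by fun_prop), lintegral_sub_right_eq_self]
    simp_rw [this]
    rw [lintegral_mul_const _ hi, lintegral_indicator_one hB]
  simp_rw [add_mul]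
  have h3 : ∀ x, ∫⁻ y, (B.indicator 1 x * k (x - y) + B.indicator 1 y * k (x - y)) =
      (∫⁻ y, B.indicator 1 x * k (x - y)) + ∫⁻ y, B.indicator 1 y * k (x - y) := fun x =>
    lintegral_add_left (by fun_prop) _
  simp_rw [h3]
  rw [lintegral_add_left, h1, h2, two_mul]
  exact Measurable.lintegral_prod_right ((hi.comp measurable_fst).mul hkp)

lemma lintegral_lintegral_sum_indicator_mul_sub (t : Finset ℕ) (w : ℕ → ℝ≥0∞)
    {k : ℕ → EuclideanSpace ℝ (Fin n) → ℝ≥0∞} (hk : ∀ j, Measurable (k j))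
    {B : ℕ → Set (EuclideanSpace ℝ (Fin n))} (hB : ∀ j, MeasurableSet (B j)) :
    ∫⁻ x, ∫⁻ y, ∑ j ∈ t, w j * (((B j).indicator 1 x + (B j).indicator 1 y) * k j (x - y)) =
      ∑ j ∈ t, w j * (2 * (volume (B j) * ∫⁻ z, k j z)) := by
  have hm : ∀ j, Measurable fun p : EuclideanSpace ℝ (Fin n) × EuclideanSpace ℝ (Fin n) =>
      ((B j).indicator (1 : EuclideanSpace ℝ (Fin n) → ℝ≥0∞) p.1 + (B j).indicator 1 p.2) *
        k j (p.1 - p.2) := fun j => by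
    have hi : Measurable ((B j).indicator (1 : EuclideanSpace ℝ (Fin n) → ℝ≥0∞)) :=
      measurable_one.indicator (hB j)
    exact ((hi.comp measurable_fst).add (hi.comp measurable_snd)).mul
      ((hk j).comp (measurable_fst.sub measurable_snd))
  have hm1 : ∀ j x, Measurable fun y =>
      ((B j).indicator (1 : EuclideanSpace ℝ (Fin n) → ℝ≥0∞) x + (B j).indicator 1 y) *
        k j (x - y) := fun j x => (hm j).comp measurable_prodMk_left
  have h2 : ∀ x, ∫⁻ y, ∑ j ∈ t, w j *
      (((B j).indicator 1 x + (B j).indicator 1 y) * k j (x - y)) =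
      ∑ j ∈ t, w j * ∫⁻ y, (((B j).indicator 1 x + (B j).indicator 1 y) * k j (x - y)) := by
    intro x
    rw [lintegral_finsetSum _ fun j _ => (hm1 j x).const_mul _]
    exact Finset.sum_congr rfl fun j _ => lintegral_const_mul _ (hm1 j x)
  simp_rw [h2]
  rw [lintegral_finsetSum _ fun j _ => (hm j).lintegral_prod_right'.const_mul _]
  refine Finset.sum_congr rfl fun j _ => ?_
  rw [← lintegral_lintegral_indicator_mul_sub (hk j) (hB j)]
  exact lintegral_const_mul _ (hm j).lintegral_prod_right'

/-- At `r = 0` both sides vanish by the conventions for division by zero and negative powers. -/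
lemma rpow_mul_min_div_rpow {σ : ℝ} (h0 : 0 < σ) (h1 : σ < 1) {R : ℝ≥0} (hR : 0 < R) (r : ℝ≥0) :
    R ^ σ * min 1 (r / R) / r ^ σ = dyadicWeight σ (r / R) := by
  rcases eq_or_ne r 0 with rfl | hr
  · simp [dyadicWeight, NNReal.zero_rpow (neg_ne_zero.2 h0.ne'), NNReal.zero_rpow h0.ne',
      NNReal.zero_rpow (show (1 - σ) ≠ 0 by linarith)]
  · have ht : r / R ≠ 0 := div_ne_zero hr hR.ne'
    have h2 : R ^ σ / r ^ σ = (r / R) ^ (-σ) := by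
      rw [NNReal.rpow_neg, NNReal.div_rpow, inv_div]
    calc R ^ σ * min 1 (r / R) / r ^ σ = R ^ σ / r ^ σ * min 1 (r / R) := by ring
      _ = dyadicWeight σ (r / R) := by
        rw [h2, dyadicWeight, mul_min, mul_one, ← NNReal.rpow_add_one ht]
        congr 2; ring

/-- Pointwise form of the modular estimate: the scales whose supports contain neither `x` nor `y`
drop out, the others carry the dyadic weights, and Jensen's inequality applies. -/
lemma map_nnnorm_dyadicSum_sub_div_le {F : Type*} [NormedAddCommGroup F]
    [NormedSpace ℝ F] {σ : ℝ} (h0 : 0 < σ) (h1 : σ < 1) {Γ : EuclideanSpace ℝ (Fin n) → F}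
    {L : ℝ≥0} (hL : 0 < L) (hΓ : ∀ x y, ‖Γ x - Γ y‖₊ ≤ L * min 1 ‖x - y‖₊)
    {B : ℕ → Set (EuclideanSpace ℝ (Fin n))}
    (hΓB : ∀ j x, x ∉ B j → Γ (((2 : ℝ) ^ j)⁻¹ • x) = 0) {D : ℝ≥0} (hD0 : 0 < D)
    (hD : ∀ (r : ℝ≥0) (N : ℕ), ∑ j ∈ Finset.range N, dyadicWeight σ (r / 2 ^ j) ≤ D)
    {A : ℝ≥0 → ℝ≥0∞} (hA : IsYoungFunction A) (N : ℕ) (a : ℕ → ℝ≥0)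
    {v : EuclideanSpace ℝ (Fin n) → F} (hv : v = fun x => ∑ j ∈ Finset.range N,
      (((L * D)⁻¹ * a j * (2 ^ j) ^ σ : ℝ≥0) : ℝ) • Γ (((2 : ℝ) ^ j)⁻¹ • x))
    (x y : EuclideanSpace ℝ (Fin n)) :
    A (‖v x - v y‖₊ / (1 * ‖x - y‖₊ ^ σ)) / ‖x - y‖ₑ ^ n ≤
      ∑ j ∈ Finset.range N, ((D : ℝ≥0∞)⁻¹ * A (a j)) *
        (((B j).indicator 1 x + (B j).indicator 1 y) * dyadicKernel σ (2 ^ j) (x - y)) := by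
  classical
  set r := ‖x - y‖₊ with hr
  -- `ι j` tells whether the scale `j` contributes at the pair `(x, y)`
  set ι : ℕ → ℝ≥0 := fun j => if x ∈ B j ∨ y ∈ B j then 1 else 0 with hι
  have hι1 : ∀ j, ι j ≤ 1 := fun j => by rw [hι]; simp only; split_ifs <;> simp
  have hιB : ∀ j, (ι j : ℝ≥0∞) ≤ (B j).indicator 1 x + (B j).indicator 1 y := fun j => by
    by_cases hx : x ∈ B j
    · simp [hι, hx]
    · by_cases hy : y ∈ B j <;> simp [hι, hx, hy]
  have hΓι : ∀ j, ‖Γ (((2 : ℝ) ^ j)⁻¹ • x) - Γ (((2 : ℝ) ^ j)⁻¹ • y)‖₊ ≤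
      ι j * (L * min 1 (r / 2 ^ j)) := fun j => by
    by_cases h : x ∈ B j ∨ y ∈ B j
    · rw [hι]
      simp only [h, if_true, one_mul]
      refine (hΓ _ _).trans (le_of_eq ?_)
      rw [← smul_sub, nnnorm_smul, nnnorm_inv, nnnorm_pow, ← hr, div_eq_mul_inv, mul_comm r]
      simp
    · rw [not_or] at h
      simp [hΓB j x h.1, hΓB j y h.2]
  have hstep : ‖v x - v y‖₊ / (1 * r ^ σ) ≤
      ∑ j ∈ Finset.range N, (D⁻¹ * dyadicWeight σ (r / 2 ^ j) * ι j) * a j := by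
    rw [hv]
    simp only
    rw [← Finset.sum_sub_distrib, one_mul]
    calc ‖∑ j ∈ Finset.range N, ((((L * D)⁻¹ * a j * (2 ^ j) ^ σ : ℝ≥0) : ℝ) •
            Γ (((2 : ℝ) ^ j)⁻¹ • x) - (((L * D)⁻¹ * a j * (2 ^ j) ^ σ : ℝ≥0) : ℝ) •
            Γ (((2 : ℝ) ^ j)⁻¹ • y))‖₊ / r ^ σ
        ≤ (∑ j ∈ Finset.range N, ((L * D)⁻¹ * a j * (2 ^ j) ^ σ) *
            (ι j * (L * min 1 (r / 2 ^ j)))) / r ^ σ := by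
          gcongr
          refine (nnnorm_sum_le _ _).trans (Finset.sum_le_sum fun j _ => ?_)
          rw [← smul_sub, nnnorm_smul, NNReal.nnnorm_eq]
          gcongr
          exact hΓι j
      _ = _ := by
          rw [Finset.sum_div]
          refine Finset.sum_congr rfl fun j _ => ?_
          rw [← rpow_mul_min_div_rpow h0 h1 (by positivity : (0 : ℝ≥0) < 2 ^ j) r, mul_inv]
          calc _ = (L⁻¹ * L) * (D⁻¹ * ((2 ^ j) ^ σ * min 1 (r / 2 ^ j) / r ^ σ) * ι j * a j) := by
                ring
            _ = _ := by rw [inv_mul_cancel₀ hL.ne', one_mul]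
  have hw : ∑ j ∈ Finset.range N, D⁻¹ * dyadicWeight σ (r / 2 ^ j) * ι j ≤ 1 := by
    calc _ ≤ ∑ j ∈ Finset.range N, D⁻¹ * dyadicWeight σ (r / 2 ^ j) :=
          Finset.sum_le_sum fun j _ => mul_le_of_le_one_right zero_le (hι1 j)
      _ ≤ D⁻¹ * D := by rw [← Finset.mul_sum]; gcongr; exact hD r N
      _ = 1 := inv_mul_cancel₀ hD0.ne'
  refine (ENNReal.div_le_div_right ((hA.monotone hstep).trans (hA.map_sum_le _ _ a hw)) _).trans ?_
  rw [div_eq_mul_inv, Finset.sum_mul]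
  refine Finset.sum_le_sum fun j _ => ?_
  rw [dyadicKernel, ← hr]
  calc _ = ((D : ℝ≥0∞)⁻¹ * A (a j)) *
        ((ι j : ℝ≥0∞) * (dyadicWeight σ (r / 2 ^ j) / ‖x - y‖ₑ ^ n)) := by
        rw [ENNReal.coe_mul, ENNReal.coe_mul, ENNReal.coe_inv hD0.ne', ENNReal.div_eq_inv_mul]
        ring
    _ ≤ _ := by gcongr; exact hιB j

/-- The modular of a superposition of dilates `R ^ σ Γ (x / R)`, `R = 2 ^ j`, of one bounded,
Lipschitz and compactly supported profile `Γ` is controlled by the scales separately: at each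
pair of points the weights of the scales have a bounded sum, so that Jensen's inequality applies,
and the integral of each weight is scale invariant. -/
lemma exists_fracModular_dyadic_le (hn : 1 ≤ n) {F : Type*} [NormedAddCommGroup F]
    [NormedSpace ℝ F] {σ : ℝ} (h0 : 0 < σ) (h1 : σ < 1) {Γ : EuclideanSpace ℝ (Fin n) → F}
    {L : ℝ≥0} (hL : 0 < L) (hΓ : ∀ x y, ‖Γ x - Γ y‖₊ ≤ L * min 1 ‖x - y‖₊) {ρ : ℝ}
    (hρ : ∀ x, ρ ≤ ‖x‖ → Γ x = 0) :
    ∃ c C : ℝ≥0, 0 < c ∧ ∀ A : ℝ≥0 → ℝ≥0∞, IsYoungFunction A → ∀ (N : ℕ) (a : ℕ → ℝ≥0),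
      fracModular σ A (fun x => ∑ j ∈ Finset.range N,
        ((c * a j * (2 ^ j) ^ σ : ℝ≥0) : ℝ) • Γ (((2 : ℝ) ^ j)⁻¹ • x)) 1 ≤
      C * ∑ j ∈ Finset.range N, (2 : ℝ≥0∞) ^ (n * j) * A (a j) := by
  obtain ⟨D, hD0, hD⟩ := exists_sum_dyadicWeight_le h0 h1
  set K : ℝ≥0∞ := ∫⁻ z : EuclideanSpace ℝ (Fin n), dyadicKernel σ 1 z with hK
  have hKt : K < ∞ := lintegral_dyadicKernel_one_lt_top hn h0 h1
  set V : ℝ≥0∞ := volume (Metric.ball (0 : EuclideanSpace ℝ (Fin n)) ρ) with hV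
  have hVt : V < ∞ := measure_ball_lt_top
  set C : ℝ≥0∞ := (D : ℝ≥0∞)⁻¹ * (2 * (V * K)) with hC
  have hCt : C ≠ ∞ := ENNReal.mul_ne_top (by simp [hD0.ne'])
    (ENNReal.mul_ne_top (by simp) (ENNReal.mul_ne_top hVt.ne hKt.ne))
  refine ⟨(L * D)⁻¹, C.toNNReal, inv_pos.2 (mul_pos hL hD0), fun A hA N a => ?_⟩
  rw [ENNReal.coe_toNNReal hCt]
  set v : EuclideanSpace ℝ (Fin n) → F := fun x => ∑ j ∈ Finset.range N,
    (((L * D)⁻¹ * a j * (2 ^ j) ^ σ : ℝ≥0) : ℝ) • Γ (((2 : ℝ) ^ j)⁻¹ • x) with hv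
  set B : ℕ → Set (EuclideanSpace ℝ (Fin n)) := fun j => Metric.ball 0 (2 ^ j * ρ) with hB
  have hBV : ∀ j, volume (B j) = 2 ^ (n * j) * V := by
    intro j
    rw [hB, hV, Measure.addHaar_ball_mul_of_pos volume _ (by positivity),
      finrank_euclideanSpace_fin, ENNReal.ofReal_pow (by positivity),
      ENNReal.ofReal_pow (by norm_num), ← pow_mul, mul_comm n]
    simp
  have hΓB : ∀ j x, x ∉ B j → Γ (((2 : ℝ) ^ j)⁻¹ • x) = 0 := by
    intro j x hx
    rw [hB, mem_ball_zero_iff, not_lt] at hx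
    refine hρ _ ?_
    rwa [norm_smul, norm_inv, norm_pow, Real.norm_ofNat, inv_mul_eq_div,
      le_div_iff₀' (by positivity)]
  have hpt : ∀ x y, A (‖v x - v y‖₊ / (1 * ‖x - y‖₊ ^ σ)) / ‖x - y‖ₑ ^ n ≤
      ∑ j ∈ Finset.range N, ((D : ℝ≥0∞)⁻¹ * A (a j)) *
        (((B j).indicator 1 x + (B j).indicator 1 y) * dyadicKernel σ (2 ^ j) (x - y)) :=
    map_nnnorm_dyadicSum_sub_div_le h0 h1 hL hΓ hΓB hD0 hD hA N a hv
  calc fracModular σ A v 1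
      ≤ ∫⁻ x, ∫⁻ y, ∑ j ∈ Finset.range N, ((D : ℝ≥0∞)⁻¹ * A (a j)) *
        (((B j).indicator 1 x + (B j).indicator 1 y) * dyadicKernel σ (2 ^ j) (x - y)) :=
        lintegral_mono fun x => lintegral_mono fun y => hpt x y
    _ = ∑ j ∈ Finset.range N, ((D : ℝ≥0∞)⁻¹ * A (a j)) * (2 * (volume (B j) * K)) := by
        rw [lintegral_lintegral_sum_indicator_mul_sub _ _
          (fun j => measurable_dyadicKernel σ (2 ^ j)) (fun j => measurableSet_ball)]
        refine Finset.sum_congr rfl fun j _ => ?_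
        rw [lintegral_dyadicKernel σ (by positivity)]
    _ = C * ∑ j ∈ Finset.range N, (2 : ℝ≥0∞) ^ (n * j) * A (a j) := by
        rw [Finset.mul_sum]
        refine Finset.sum_congr rfl fun j _ => ?_
        rw [hBV, hC]; ring

end

section

variable {n : ℕ}

/-! ### Distance of a monomial to polynomials of lower degree -/

lemma Polynomial.fwdDiff_iter_eq_coeff_mul_factorial {P : Polynomial ℝ} {d : ℕ}
    (hP : P.natDegree ≤ d) (y : ℝ) :
    (fwdDiff 1)^[d] (fun t => P.eval t) y = P.coeff d * d.factorial := by
  rcases hP.lt_or_eq with h | h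
  · rw [Polynomial.fwdDiff_iter_eq_zero_of_degree_lt h, Polynomial.coeff_eq_zero_of_natDegree_lt h]
    simp
  · subst h
    rw [Polynomial.fwdDiff_iter_degree_eq_factorial]
    simp

/-- A finite difference of order `k + 1` along the `i₀`-th axis annihilates polynomials of degree
at most `k` and turns `(x i₀) ^ (k + 1)` into a constant. -/
lemma sum_choose_mul_monomial_sub_eval (i₀ : Fin n) (k : ℕ) (M h : ℝ) {P : MvPolynomial (Fin n) ℝ}
    (hP : P.totalDegree ≤ k) (x : EuclideanSpace ℝ (Fin n)) :
    ∑ l ∈ Finset.range (k + 1 + 1), ((-1 : ℤ) ^ (k + 1 - l) * (k + 1).choose l) •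
      (M * (x + (l * h) • EuclideanSpace.single i₀ (1 : ℝ)) i₀ ^ (k + 1) - MvPolynomial.eval
        (fun i => (x + (l * h) • EuclideanSpace.single i₀ (1 : ℝ)) i) P) =
      M * h ^ (k + 1) * (k + 1).factorial := by
  set e : EuclideanSpace ℝ (Fin n) := EuclideanSpace.single i₀ 1 with he
  set line : Fin n → Polynomial ℝ := fun i =>
    Polynomial.C (h * e i) * Polynomial.X + Polynomial.C (x i) with hline
  set Q : Polynomial ℝ := MvPolynomial.aeval line P with hQ
  have hQdeg : Q.natDegree ≤ k := by
    simpa using MvPolynomial.aeval_natDegree_le P hP line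
      (fun i => Polynomial.natDegree_linear_le (a := h * e i) (b := x i))
  set S : Polynomial ℝ := Polynomial.C M * line i₀ ^ (k + 1) with hS
  have hl1 : (line i₀).natDegree ≤ 1 := Polynomial.natDegree_linear_le
  have hSdeg : S.natDegree ≤ k + 1 := by
    refine (Polynomial.natDegree_C_mul_le _ _).trans ?_
    simpa using Polynomial.natDegree_pow_le_of_le (k + 1) hl1
  have hcoeff : (S - Q).coeff (k + 1) = M * h ^ (k + 1) := by
    rw [Polynomial.coeff_sub, Polynomial.coeff_eq_zero_of_natDegree_lt (Nat.lt_succ_of_le hQdeg),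
      sub_zero, hS, Polynomial.coeff_C_mul]
    have := Polynomial.coeff_pow_of_natDegree_le (m := k + 1) hl1
    rw [mul_one] at this
    rw [this, hline]
    simp [he]
  have hmain := Polynomial.fwdDiff_iter_eq_coeff_mul_factorial (P := S - Q) (d := k + 1)
    ((Polynomial.natDegree_sub_le _ _).trans (max_le hSdeg (hQdeg.trans (Nat.le_succ _)))) 0
  rw [hcoeff, fwdDiff_iter_eq_sum_shift] at hmain
  rw [← hmain]
  refine Finset.sum_congr rfl fun l _ => ?_
  congr 1
  have hlinel : ∀ i, (line i).eval (l : ℝ) = (x + (l * h) • e) i := fun i => by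
    simp [hline]; ring
  have hQl : Q.eval (l : ℝ) = MvPolynomial.eval (fun i => (x + (l * h) • e) i) P := by
    rw [hQ, ← Polynomial.coe_aeval_eq_eval, MvPolynomial.comp_aeval_apply,
      ← funext hlinel, ← MvPolynomial.aeval_eq_eval]
    rfl
  rw [zero_add, nsmul_one, Polynomial.eval_sub, hQl, hS, Polynomial.eval_mul, Polynomial.eval_pow,
    hlinel, Polynomial.eval_C]

/-- The monomial `(x i₀) ^ (k + 1)` has positive distance to the polynomials of degree at most `k`
in `L¹` of the unit ball. -/
lemma exists_mul_le_lintegral_monomial_sub (i₀ : Fin n) (k : ℕ) :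
    ∃ κ : ℝ≥0∞, κ ≠ 0 ∧ ∀ (M : ℝ≥0) (P : MvPolynomial (Fin n) ℝ), P.totalDegree ≤ k →
      M * κ ≤ 2 ^ (k + 1) * ∫⁻ x in Metric.ball (0 : EuclideanSpace ℝ (Fin n)) 1,
        ‖M * x i₀ ^ (k + 1) - MvPolynomial.eval (fun i => x i) P‖ₑ := by
  -- with this step, the `k + 1` translates of the ball of radius `1 / 2` stay in the unit ball
  set h : ℝ := 1 / (2 * (k + 2)) with hh
  have hh0 : 0 < h := by positivity
  refine ⟨ENNReal.ofReal (h ^ (k + 1) * (k + 1).factorial) *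
    volume (Metric.ball (0 : EuclideanSpace ℝ (Fin n)) (1 / 2)), ?_, fun M P hP => ?_⟩
  · refine mul_ne_zero (by rw [Ne, ENNReal.ofReal_eq_zero, not_le]; positivity) ?_
    exact (Metric.measure_ball_pos _ _ (by norm_num)).ne'
  set f : EuclideanSpace ℝ (Fin n) → ℝ := fun x =>
    M * x i₀ ^ (k + 1) - MvPolynomial.eval (fun i => x i) P with hf
  have hfm : Measurable f := by
    have hcont : Continuous f := by
      have h1 : Continuous fun x : EuclideanSpace ℝ (Fin n) =>
          MvPolynomial.eval (fun i => x i) P :=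
        (MvPolynomial.continuous_eval P).comp (by fun_prop)
      exact (by fun_prop : Continuous fun x : EuclideanSpace ℝ (Fin n) =>
        (M : ℝ) * x i₀ ^ (k + 1)).sub h1
    exact hcont.measurable
  set w : ℕ → EuclideanSpace ℝ (Fin n) := fun l => (l * h) • EuclideanSpace.single i₀ (1 : ℝ)
    with hw
  have hpt : ∀ x, M * ENNReal.ofReal (h ^ (k + 1) * (k + 1).factorial) ≤
      ∑ l ∈ Finset.range (k + 1 + 1), ((k + 1).choose l : ℝ≥0∞) * ‖f (x + w l)‖ₑ := by
    intro x
    have h1 := sum_choose_mul_monomial_sub_eval i₀ k M h hP x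
    calc M * ENNReal.ofReal (h ^ (k + 1) * (k + 1).factorial)
        = ‖(M : ℝ) * h ^ (k + 1) * (k + 1).factorial‖ₑ := by
          rw [mul_assoc, enorm_mul, Real.enorm_of_nonneg (by positivity : 0 ≤ h ^ (k + 1) * _),
            Real.enorm_of_nonneg M.coe_nonneg, ENNReal.ofReal_coe_nnreal]
      _ ≤ _ := by
          rw [← h1]
          refine (enorm_sum_le _ _).trans (Finset.sum_le_sum fun l _ => le_of_eq ?_)
          rw [zsmul_eq_mul, enorm_mul]
          congr 1
          push_cast
          rw [enorm_mul, enorm_pow, enorm_neg, enorm_one, one_pow, one_mul,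
            Real.enorm_of_nonneg (by positivity), ENNReal.ofReal_natCast]
  have hshift : ∀ l ∈ Finset.range (k + 1 + 1),
      ∫⁻ x in Metric.ball (0 : EuclideanSpace ℝ (Fin n)) (1 / 2), ‖f (x + w l)‖ₑ ≤
        ∫⁻ x in Metric.ball (0 : EuclideanSpace ℝ (Fin n)) 1, ‖f x‖ₑ := by
    intro l hl
    have hl' : (l : ℝ) ≤ k + 1 := by
      exact_mod_cast Nat.le_of_lt_succ (Finset.mem_range.1 hl)
    have hwl : ‖w l‖ < 1 / 2 := by
      rw [hw]
      simp only [norm_smul, PiLp.norm_single, norm_one, mul_one]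
      rw [Real.norm_of_nonneg (by positivity), hh, mul_one_div, div_lt_div_iff₀ (by positivity)
        (by norm_num)]
      linarith
    rw [← lintegral_indicator measurableSet_ball, ← lintegral_indicator measurableSet_ball,
      ← lintegral_add_right_eq_self ((Metric.ball 0 1).indicator _) (w l)]
    refine lintegral_mono fun x => ?_
    by_cases hx : x ∈ Metric.ball (0 : EuclideanSpace ℝ (Fin n)) (1 / 2)
    · have hxw : x + w l ∈ Metric.ball (0 : EuclideanSpace ℝ (Fin n)) 1 := by
        rw [mem_ball_zero_iff] at hx ⊢
        linarith [norm_add_le x (w l)]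
      rw [indicator_of_mem hx, indicator_of_mem hxw]
    · rw [indicator_of_notMem hx]; exact zero_le
  calc M * (ENNReal.ofReal (h ^ (k + 1) * (k + 1).factorial) *
        volume (Metric.ball (0 : EuclideanSpace ℝ (Fin n)) (1 / 2)))
      = ∫⁻ _ in Metric.ball (0 : EuclideanSpace ℝ (Fin n)) (1 / 2),
          M * ENNReal.ofReal (h ^ (k + 1) * (k + 1).factorial) := by
        rw [setLIntegral_const, mul_assoc]
    _ ≤ ∫⁻ x in Metric.ball (0 : EuclideanSpace ℝ (Fin n)) (1 / 2),
          ∑ l ∈ Finset.range (k + 1 + 1), ((k + 1).choose l : ℝ≥0∞) * ‖f (x + w l)‖ₑ :=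
        lintegral_mono hpt
    _ = ∑ l ∈ Finset.range (k + 1 + 1), ((k + 1).choose l : ℝ≥0∞) *
          ∫⁻ x in Metric.ball (0 : EuclideanSpace ℝ (Fin n)) (1 / 2), ‖f (x + w l)‖ₑ := by
        rw [lintegral_finsetSum _ fun l _ => by fun_prop]
        exact Finset.sum_congr rfl fun l _ => lintegral_const_mul _ (by fun_prop)
    _ ≤ ∑ l ∈ Finset.range (k + 1 + 1), ((k + 1).choose l : ℝ≥0∞) *
          ∫⁻ x in Metric.ball (0 : EuclideanSpace ℝ (Fin n)) 1, ‖f x‖ₑ :=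
        Finset.sum_le_sum fun l hl => by exact mul_le_mul_right (hshift l hl) _
    _ = 2 ^ (k + 1) * ∫⁻ x in Metric.ball (0 : EuclideanSpace ℝ (Fin n)) 1, ‖f x‖ₑ := by
        rw [← Finset.sum_mul, ← Nat.cast_sum, Nat.sum_range_choose]
        push_cast; rfl

/-! ### Consequences of the embedding for smooth functions -/

lemma fracModular_congr_ae {F : Type*} [NormedAddCommGroup F] {σ : ℝ} {A : ℝ≥0 → ℝ≥0∞}
    {v w : EuclideanSpace ℝ (Fin n) → F} (h : v =ᵐ[volume] w) (l : ℝ≥0) :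
    fracModular σ A v l = fracModular σ A w l := by
  refine lintegral_congr_ae ?_
  filter_upwards [h] with x hx
  refine lintegral_congr_ae ?_
  filter_upwards [h] with y hy
  rw [hx, hy]

lemma orliczSobolevSeminorm_le_one {s : ℝ} {A : ℝ≥0 → ℝ≥0∞} {u : EuclideanSpace ℝ (Fin n) → ℝ}
    (hu : ContDiff ℝ (⊤ : ℕ∞) u)
    (hmod : fracModular (Int.fract s) A (classicalGrad ⌊s⌋₊ u) 1 ≤ 1) :
    orliczSobolevSeminorm s A u ≤ 1 := by
  rw [← fracModular_congr_ae (weakGrad_ae_eq_classicalGrad hu _)] at hmod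
  exact (iInf_le _ 1).trans ((iInf_le _ one_pos).trans (iInf_le _ hmod))

lemma mem_orliczSobolevDecaySpace {s : ℝ} {A : ℝ≥0 → ℝ≥0∞} {u : EuclideanSpace ℝ (Fin n) → ℝ}
    (hu : ContDiff ℝ (⊤ : ℕ∞) u) (huc : HasCompactSupport u)
    (hmod : fracModular (Int.fract s) A (classicalGrad ⌊s⌋₊ u) 1 ≤ 1) (m : ℕ) :
    u ∈ orliczSobolevDecaySpace n s A m := by
  refine ⟨⟨fun h _ => ⟨_, isWeakGrad_classicalGrad hu h⟩,
    (orliczSobolevSeminorm_le_one hu hmod).trans_lt ENNReal.one_lt_top⟩, fun h _ _ t ht => ?_⟩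
  have h1 : volume {x | t < ‖weakGrad h u x‖} ≤ volume {x | t < ‖classicalGrad h u x‖} := by
    refine measure_mono_ae ?_
    filter_upwards [weakGrad_ae_eq_classicalGrad hu h] with x hx hlt
    change t < _ at hlt
    rwa [hx] at hlt
  refine h1.trans_lt (lt_of_le_of_lt (measure_mono fun x hx => ?_)
    (hasCompactSupport_classicalGrad huc h).isCompact.measure_lt_top)
  refine subset_tsupport _ fun h0 => ?_
  change t < _ at hx
  rw [h0, norm_zero] at hx
  exact lt_asymm ht hx

lemma averagingPolynomial_totalDegree_le (k : ℕ) (B : Set (EuclideanSpace ℝ (Fin n)))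
    (u : EuclideanSpace ℝ (Fin n) → ℝ) : (averagingPolynomial k B u).totalDegree ≤ k := by
  rw [averagingPolynomial]
  split_ifs with H
  · exact H.choose_spec.1
  · simp

/-- The embedding bounds, by one constant, the distance to polynomials of degree at most `k` on the
unit ball of all smooth compactly supported functions in the unit ball of the domain space. -/
lemma CampanatoEmbedding.exists_lintegral_le {s : ℝ} {A : ℝ≥0 → ℝ≥0∞} {m k : ℕ} {φ : ℝ → ℝ}
    (hemb : CampanatoEmbedding n s A m k φ) :
    ∃ Q : ℝ≥0∞, Q ≠ ∞ ∧ ∀ u : EuclideanSpace ℝ (Fin n) → ℝ, ContDiff ℝ (⊤ : ℕ∞) u →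
      HasCompactSupport u → fracModular (Int.fract s) A (classicalGrad ⌊s⌋₊ u) 1 ≤ 1 →
      ∃ P : MvPolynomial (Fin n) ℝ, P.totalDegree ≤ k ∧
        ∫⁻ x in Metric.ball (0 : EuclideanSpace ℝ (Fin n)) 1,
          ‖u x - MvPolynomial.eval (fun i => x i) P‖ₑ ≤ Q := by
  obtain ⟨-, c, hc⟩ := hemb
  set V := volume (Metric.ball (0 : EuclideanSpace ℝ (Fin n)) 1) with hV
  set v := volume.real (Metric.ball (0 : EuclideanSpace ℝ (Fin n)) 1) with hv
  set d := ENNReal.ofReal (φ (v ^ (1 / (n : ℝ))) * v ^ ((k : ℝ) / (n : ℝ))) with hd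
  have hVt : V ≠ ∞ := measure_ball_lt_top.ne
  have hV0 : V ≠ 0 := (Metric.measure_ball_pos _ _ one_pos).ne'
  have hdt : d ≠ ∞ := ENNReal.ofReal_ne_top
  refine ⟨c * d * V, ENNReal.mul_ne_top (ENNReal.mul_ne_top ENNReal.coe_ne_top hdt) hVt,
    fun u hu huc hmod => ⟨averagingPolynomial k (Metric.ball 0 1) u,
      averagingPolynomial_totalDegree_le _ _ _, ?_⟩⟩
  have h1 : campanatoSeminorm k φ u ≤ c :=
    (hc u (mem_orliczSobolevDecaySpace hu huc hmod m)).trans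
      (mul_le_of_le_one_right zero_le (orliczSobolevSeminorm_le_one hu hmod))
  have h2 := (le_iSup_of_le (0 : EuclideanSpace ℝ (Fin n))
    (le_iSup_of_le (1 : ℝ) (le_iSup_of_le one_pos le_rfl))).trans h1
  rw [ENNReal.div_le_iff_le_mul (Or.inr ENNReal.coe_ne_top) (Or.inl hdt),
    ENNReal.div_le_iff_le_mul (Or.inl hV0) (Or.inl hVt)] at h2
  exact h2

/-! ### Superpositions of dilates of a profile -/

lemma exists_smooth_eq_monomial (i₀ : Fin n) (k : ℕ) :
    ∃ Ψ : EuclideanSpace ℝ (Fin n) → ℝ, ContDiff ℝ (⊤ : ℕ∞) Ψ ∧ HasCompactSupport Ψ ∧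
      ∀ x, ‖x‖ ≤ 1 → Ψ x = x i₀ ^ (k + 1) := by
  let χ : ContDiffBump (0 : EuclideanSpace ℝ (Fin n)) := ⟨1, 2, one_pos, one_lt_two⟩
  refine ⟨fun x => x i₀ ^ (k + 1) * χ x, ?_, χ.hasCompactSupport.mul_left, fun x hx => ?_⟩
  · exact ((contDiff_euclidean.1 contDiff_id i₀).pow _).mul χ.contDiff
  · simp only
    rw [χ.one_of_mem_closedBall (by simpa using hx), mul_one]

lemma classicalGrad_sum_dilates {Ψ : EuclideanSpace ℝ (Fin n) → ℝ} (hΨ : ContDiff ℝ (⊤ : ℕ∞) Ψ)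
    (h : ℕ) (t : Finset ℕ) (b R : ℕ → ℝ) (x : EuclideanSpace ℝ (Fin n)) :
    classicalGrad h (fun x => ∑ j ∈ t, b j * Ψ (R j • x)) x =
      ∑ j ∈ t, (b j * R j ^ h) • classicalGrad h Ψ (R j • x) := by
  have hd : ∀ j, ContDiff ℝ (⊤ : ℕ∞) fun x => Ψ (R j • x) := fun j =>
    hΨ.comp (contDiff_const_smul (R j))
  have hle : ((h : ℕ) : WithTop ℕ∞) ≤ ((⊤ : ℕ∞) : WithTop ℕ∞) := by exact_mod_cast le_top
  have h1 : iteratedFDeriv ℝ h (fun x => ∑ j ∈ t, b j * Ψ (R j • x)) x =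
      ∑ j ∈ t, (b j * R j ^ h) • iteratedFDeriv ℝ h Ψ (R j • x) := by
    rw [iteratedFDeriv_fun_sum_apply fun j _ =>
      ((contDiff_const.mul (hd j)).of_le hle).contDiffAt]
    refine Finset.sum_congr rfl fun j _ => ?_
    simp_rw [← smul_eq_mul (b j)]
    rw [iteratedFDeriv_const_smul_apply' ((hd j).of_le hle).contDiffAt,
      iteratedFDeriv_comp_const_smul (R j) (hΨ.of_le hle), smul_smul, smul_eq_mul]
  ext i
  simp [classicalGrad, h1]

lemma exists_bounded_lipschitz_const {E F : Type*} [NormedAddCommGroup E] [NormedSpace ℝ E]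
    [NormedAddCommGroup F] [NormedSpace ℝ F] {Γ : E → F}
    (hΓ : ContDiff ℝ (⊤ : ℕ∞) Γ) (hc : HasCompactSupport Γ) :
    ∃ L : ℝ≥0, 0 < L ∧ ∀ x y, ‖Γ x - Γ y‖₊ ≤ L * min 1 ‖x - y‖₊ := by
  obtain ⟨K, hK⟩ := hΓ.lipschitzWith_of_hasCompactSupport hc (by simp)
  obtain ⟨C, hC⟩ := hc.exists_bound_of_continuous hΓ.continuous
  refine ⟨K + 2 * C.toNNReal + 1, by positivity, fun x y => ?_⟩
  have hC' : ∀ z, ‖Γ z‖₊ ≤ C.toNNReal := fun z => NNReal.le_toNNReal_of_coe_le (hC z)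
  rw [mul_min, mul_one, le_min_iff]
  constructor
  · calc ‖Γ x - Γ y‖₊ ≤ ‖Γ x‖₊ + ‖Γ y‖₊ := nnnorm_sub_le _ _
      _ ≤ C.toNNReal + C.toNNReal := add_le_add (hC' x) (hC' y)
      _ = 2 * C.toNNReal := (two_mul _).symm
      _ ≤ K + 2 * C.toNNReal + 1 := le_add_self.trans le_self_add
  · calc ‖Γ x - Γ y‖₊ ≤ K * ‖x - y‖₊ := by
          simpa [← NNReal.coe_le_coe, dist_eq_norm] using hK.dist_le_mul x y
      _ ≤ _ := by gcongr; rw [add_assoc]; exact le_self_add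

/-- A dyadic superposition of dilates of a cut-off monomial `(x i₀) ^ (k + 1)` with modular at
most `1`: on the unit ball it is a multiple of that monomial, with the sum over all scales as the
factor. -/
lemma exists_smooth_fracModular_le_one (i₀ : Fin n) {s : ℝ} (hs_int : ∀ m : ℕ, s ≠ m) (hs : 0 < s)
    (k : ℕ) :
    ∃ c ε : ℝ≥0, 0 < c ∧ 0 < ε ∧ ∀ A : ℝ≥0 → ℝ≥0∞, IsYoungFunction A → ∀ (N : ℕ) (a : ℕ → ℝ≥0),
      ∑ j ∈ Finset.range N, (2 : ℝ≥0∞) ^ (n * j) * A (a j) ≤ ε →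
      ∃ u : EuclideanSpace ℝ (Fin n) → ℝ, ContDiff ℝ (⊤ : ℕ∞) u ∧ HasCompactSupport u ∧
        fracModular (Int.fract s) A (classicalGrad ⌊s⌋₊ u) 1 ≤ 1 ∧
        ∀ x ∈ Metric.ball (0 : EuclideanSpace ℝ (Fin n)) 1,
          u x = (c * ∑ j ∈ Finset.range N, (2 : ℝ≥0) ^ ((s - (k + 1)) * j) * a j : ℝ≥0) *
            x i₀ ^ (k + 1) := by
  have hn : 1 ≤ n := i₀.pos
  have hfloor : ((⌊s⌋₊ : ℕ) : ℝ) = (⌊s⌋ : ℝ) := natCast_floor_eq_intCast_floor hs.le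
  have hfr : Int.fract s = s - ⌊s⌋₊ := by rw [hfloor]; rfl
  have h0 : 0 < Int.fract s := by
    refine (Int.fract_nonneg s).lt_of_ne fun h => hs_int ⌊s⌋₊ ?_
    linarith
  have h1 : Int.fract s < 1 := Int.fract_lt_one s
  obtain ⟨Ψ, hΨ, hΨc, hΨ1⟩ := exists_smooth_eq_monomial i₀ k
  have hΓ := contDiff_classicalGrad hΨ ⌊s⌋₊
  have hΓc := hasCompactSupport_classicalGrad hΨc ⌊s⌋₊
  obtain ⟨L, hL, hΓL⟩ := exists_bounded_lipschitz_const hΓ hΓc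
  obtain ⟨ρ, -, hρ⟩ := hΓc.exists_pos_le_norm
  obtain ⟨c, C, hc, hmod⟩ := exists_fracModular_dyadic_le hn h0 h1 hL hΓL hρ
  refine ⟨c, (C + 1)⁻¹, hc, by positivity, fun A hA N a ha => ?_⟩
  set R : ℕ → ℝ := fun j => ((2 : ℝ) ^ j)⁻¹ with hR
  set b : ℕ → ℝ := fun j => c * a j * ((2 : ℝ) ^ j) ^ s with hb
  have hbR : ∀ (j m : ℕ), b j * R j ^ m = c * a j * ((2 : ℝ) ^ j) ^ (s - m) := fun j m => by
    rw [hb, hR]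
    simp only
    rw [Real.rpow_sub (by positivity), Real.rpow_natCast, inv_pow, ← div_eq_mul_inv, mul_div_assoc]
  refine ⟨fun x => ∑ j ∈ Finset.range N, b j * Ψ (R j • x), ?_, ?_, ?_, ?_⟩
  · exact ContDiff.sum fun j _ => contDiff_const.mul (hΨ.comp (contDiff_const_smul (R j)))
  · have hcs : ∀ j, HasCompactSupport fun x => b j * Ψ (R j • x) := fun j =>
      (hΨc.comp_smul (by rw [hR]; positivity)).mul_left
    have : (fun x => ∑ j ∈ Finset.range N, b j * Ψ (R j • x)) =
        ∑ j ∈ Finset.range N, fun x => b j * Ψ (R j • x) := by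
      ext x; simp
    rw [this]
    exact Finset.sum_induction _ HasCompactSupport (fun _ _ => HasCompactSupport.add)
      HasCompactSupport.zero fun j _ => hcs j
  · have hgrad : classicalGrad ⌊s⌋₊ (fun x => ∑ j ∈ Finset.range N, b j * Ψ (R j • x)) =
        fun x => ∑ j ∈ Finset.range N, ((c * a j * (2 ^ j) ^ Int.fract s : ℝ≥0) : ℝ) •
          classicalGrad ⌊s⌋₊ Ψ (((2 : ℝ) ^ j)⁻¹ • x) := by
      ext1 x
      rw [classicalGrad_sum_dilates hΨ]
      refine Finset.sum_congr rfl fun j _ => ?_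
      rw [hbR, hfr]
      push_cast
      rfl
    rw [hgrad]
    refine (hmod A hA N a).trans ?_
    calc (C : ℝ≥0∞) * ∑ j ∈ Finset.range N, (2 : ℝ≥0∞) ^ (n * j) * A (a j)
        ≤ C * ((C + 1)⁻¹ : ℝ≥0) := by gcongr
      _ ≤ 1 := by
        rw [← ENNReal.coe_mul, ← div_eq_mul_inv]
        exact_mod_cast div_le_one_of_le₀ le_self_add zero_le
  · intro x hx
    rw [mem_ball_zero_iff] at hx
    push_cast
    rw [Finset.mul_sum, Finset.sum_mul]
    refine Finset.sum_congr rfl fun j _ => ?_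
    have hx1 : ‖R j • x‖ ≤ 1 := by
      rw [norm_smul, hR, norm_inv, norm_pow, Real.norm_ofNat]
      exact mul_le_one₀ (inv_le_one_of_one_le₀ (one_le_pow₀ one_le_two)) (norm_nonneg _) hx.le
    rw [hΨ1 _ hx1, PiLp.smul_apply, smul_eq_mul, mul_pow, ← mul_assoc, hbR]
    have : (2 : ℝ) ^ ((s - (k + 1)) * j) = ((2 : ℝ) ^ j) ^ (s - ((k + 1 : ℕ) : ℝ)) := by
      rw [← Real.rpow_natCast 2 j, ← Real.rpow_mul (by norm_num)]
      congr 1; push_cast; ring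
    rw [this]; ring

/-- Sequences with small modular and large weighted sum are incompatible with the embedding. -/
lemma CampanatoEmbedding.not_forall_exists_dyadic_sum_ge (hn : 1 ≤ n) {s : ℝ}
    (hs_int : ∀ m : ℕ, s ≠ m) (hs : 0 < s) {A : ℝ≥0 → ℝ≥0∞} (hA : IsYoungFunction A) {m k : ℕ}
    {φ : ℝ → ℝ} (hemb : CampanatoEmbedding n s A m k φ) :
    ¬ ∀ b ε : ℝ≥0, 0 < ε → ∃ (N : ℕ) (a : ℕ → ℝ≥0),
      ∑ j ∈ Finset.range N, (2 : ℝ≥0∞) ^ (n * j) * A (a j) ≤ ε ∧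
      b ≤ ∑ j ∈ Finset.range N, (2 : ℝ≥0) ^ ((s - (k + 1)) * j) * a j := by
  intro H
  have i₀ : Fin n := ⟨0, hn⟩
  obtain ⟨c, ε, hc, hε, hu⟩ := exists_smooth_fracModular_le_one i₀ hs_int hs k
  obtain ⟨κ, hκ, hκP⟩ := exists_mul_le_lintegral_monomial_sub i₀ k
  obtain ⟨Q, hQ, hQu⟩ := hemb.exists_lintegral_le
  obtain ⟨b, hb⟩ := ENNReal.exists_nat_mul_gt
    (mul_ne_zero (ENNReal.coe_ne_zero.2 hc.ne') hκ)
    (ENNReal.mul_ne_top (ENNReal.pow_ne_top ENNReal.ofNat_ne_top) hQ : 2 ^ (k + 1) * Q ≠ ∞)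
  obtain ⟨N, a, ha, hba⟩ := H b ε hε
  obtain ⟨u, hud, huc, humod, hu1⟩ := hu A hA N a ha
  obtain ⟨P, hP, hPQ⟩ := hQu u hud huc humod
  set M := c * ∑ j ∈ Finset.range N, (2 : ℝ≥0) ^ ((s - (k + 1)) * j) * a j with hM
  refine absurd hb (not_lt.2 ?_)
  calc (b : ℝ≥0∞) * (c * κ) = ((c * b : ℝ≥0) : ℝ≥0∞) * κ := by push_cast; ring
    _ ≤ M * κ := by rw [hM]; gcongr
    _ ≤ 2 ^ (k + 1) * ∫⁻ x in Metric.ball (0 : EuclideanSpace ℝ (Fin n)) 1,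
        ‖M * x i₀ ^ (k + 1) - MvPolynomial.eval (fun i => x i) P‖ₑ := hκP M P hP
    _ ≤ 2 ^ (k + 1) * Q := by
        gcongr
        refine le_trans (le_of_eq ?_) hPQ
        refine setLIntegral_congr_fun measurableSet_ball fun x hx => ?_
        rw [← hu1 x hx]

end

theorem mainTheorem4 (n : ℕ) (hn : 1 ≤ n) (s : ℝ) (hs : 1 < s) (hs_int : ∀ m : ℕ, s ≠ m)
    (A : ℝ≥0 → ℝ≥0∞) (hA : IsYoungFunction A) (φ : ℝ → ℝ) (hφ : IsAdmissible φ)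
    (k : ℕ) (hk : k + 1 ≤ ⌊s⌋₊) (hemb : CampanatoEmbedding n s A (k + 1) k φ) :
    s < n + k + 1 ∧
      ∃ δ : ℝ, 0 < δ ∧
        ∫⁻ t in Ioo (0 : ℝ) δ,
          (ENNReal.ofReal t / A t.toNNReal) ^ ((s - (k + 1)) / (n - (s - (k + 1)))) < ∞ := by
  have hs0 : 0 < s := zero_lt_one.trans hs
  have hno := hemb.not_forall_exists_dyadic_sum_ge hn hs_int hs0 hA
  have hγ : 0 < s - (k + 1) := by
    have h1 : ((k + 1 : ℕ) : ℝ) ≤ s := (Nat.le_floor_iff hs0.le).1 hk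
    have h2 := h1.lt_of_ne (hs_int (k + 1)).symm
    push_cast at h2
    linarith
  have hlt : s < n + k + 1 := by
    by_contra! h
    have h2 : n + k + 1 < s := h.lt_of_ne fun h' => hs_int (n + k + 1) (by push_cast; exact h'.symm)
    exact hno fun b ε hε => hA.exists_dyadic_sum_ge_of_lt (by linarith) b ε hε
  refine ⟨hlt, 1, one_pos, ?_⟩
  by_contra hI
  rw [not_lt, top_le_iff] at hI
  exact hno fun b ε hε =>
    hA.exists_dyadic_sum_ge_of_lintegral_eq_top hγ (by linarith) hI b ε hε
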